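/- **Setting.** Units $i=0,1,2,\dots$ carry covariates $X_i\in\mathbb R^d$, a treatment $W_i\in\{0,1\}$, potential outcomes $Y_i(0),Y_i(1)\in\mathbb R$ and a study membership $H_i\in\{1,\dots,K\}$; the tuples are i.i.d. and one observes $(X_i,W_i,Y_i,H_i)_{i<n}$ with $Y_i=Y_i(W_i)$. Put $\rho_k=\mathbb P(H=k)>0$, $p_k=\mathbb P(W=1\mid H=k)\in(0,1)$, $\Sigma_k=\mathbb V(X\mid H=k)$. Within each study $W$ is independent of $(X,Y(0),Y(1))$; the law of $X$ given $H=k$ and $p_k$ may depend on $k$. $X$ has finite second moments, every $\Sigma_k$ is positive definite, and $$Y(w)=c^{(w)}+X\beta^{(w)}+\varepsilon(w),\qquad \mathbb E(\varepsilon(w)\mid X,H)=0,\qquad \mathbb V(\varepsilon(w)\mid X,H)=\sigma^2>0,\qquad w\in\{0,1\}.$$ Let $\tau=\mathbb E(Y(1)-Y(0))$, $\tau_k=\mathbb E(Y(1)-Y(0)\mid H=k)$, $X'=(1,X)$, $\theta^{(w)}=(c^{(w)},\beta^{(w)})$, and let $n_k$, $n^{(w)}$, $n_k^{(w)}$ be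 the numbers of units $i<n$ in study $k$, in arm $w$, and in arm $w$ of study $k$. *Local full rank* is the event that, for all $k,w$, the design matrix with intercept $X_k'^{(w)}$ of arm $w$ in study $k$ has rank $d+1$. **Estimators.** Given coefficients $\hat\theta^{(0)},\hat\theta^{(1)}$, the G-formula over a set of units is the average of $X_i'\hat\theta^{(1)}-X_i'\hat\theta^{(0)}$ over it. * $\hat\tau_{\rm pool}$: G-formula over all $n$ units with the least squares coefficients $\hat\theta^{(w)}_{\rm pool}$ of arm $w$ of the pooled data. * $\hat\tau_{\text{Meta-SW}}=\sum_k\frac{n_k}{n}\hat\tau_k$, with $\hat\tau_k$ the G-formula over study $k$ with the local least squares coefficients $\hat\theta_k^{(w)}$. * $\hat\tau_{\text{1S-IVW}}=\sum_k\frac{n_k}n\hat\tau_k^{\text{1S-IVW}}$, with $\hat\tau_k^{\text{1S-IVW}}$ the G-formula over study $k$ with $\hat\theta^{(w)}=\big(\sum_k V_{k,w}^{-1}\big)^{-1}\sum_kV_{k,w}^{-1}\hat\theta_k^{(w)}$, $V_{k,w}=\sigma^2(X_k'^{(w)\top}X_k'^{(w)})^{-1}$. * $\hat\tau_{\rm GD}=\sum_k\frac{n_k}n\hat\tau_k^{\rm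 GD}$, with $\hat\tau_k^{\rm GD}$ the G-formula over study $k$ with the limit, as the number of communication rounds tends to infinity, of FedAvg for the mean squared error of arm $w$ (one full-batch local gradient step per round, averaging weights $n_k^{(w)}/n^{(w)}$, any fixed initial point, any measurable, possibly data-dependent learning rate $0<\eta<2/L$, $L$ the largest eigenvalue of the Hessian of the pooled mean squared error). For an estimator $\hat\tau$ write $\mathbb V^\infty(\hat\tau)=v$ if $\sqrt n(\hat\tau-\tau)\to\mathcal N(0,v)$ in distribution, and $\mathbb V^\infty_H(\hat\tau)=v$ if $\sqrt n\big(\hat\tau-\sum_k\frac{n_k}n\tau_k\big)\to\mathcal N(0,v)$ in distribution (the variability due to the study memberships being removed). Let $$v_{\rm Meta}=\sigma^2\sum_{k}\frac{\rho_k}{p_k(1-p_k)}+(\beta^{(1)}-\beta^{(0)})^\top\Big(\sum_{k}\rho_k\Sigma_k\Big)(\beta^{(1)}-\beta^{(0)}).$$ **Theorem.** 1. All the following asymptotic variances exist, and $$\mathbb V^\infty(\hat\tau_{\rm pool})=\mathbb V^\infty(\hat\tau_{\rm GD})=\mathbb V^\infty(\hat\tau_{\text{1S-IVW}})\le\mathbb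 V^\infty(\hat\tau_{\text{Meta-SW}})=v_{\rm Meta}+\sum_k\rho_k(\tau_k-\tau)^2 .$$ 2. Likewise $$\mathbb V_H^\infty(\hat\tau_{\rm pool})=\mathbb V_H^\infty(\hat\tau_{\rm GD})=\mathbb V_H^\infty(\hat\tau_{\text{1S-IVW}})\le\mathbb V_H^\infty(\hat\tau_{\text{Meta-SW}})=v_{\rm Meta}.$$ 3. $\hat\tau_{\text{Meta-SW}}$ is unbiased under local full rank, in the following sense. * If an event $S$ depends only on $(H_i,W_i)_{i<n}$, local full rank holds almost surely on $S$, and $\hat\tau_{\text{Meta-SW}}$ is integrable on $S$, then $\mathbb E(\hat\tau_{\text{Meta-SW}}\mathbf 1_S)=\mathbb E\big(\sum_k\frac{n_k}n\tau_k\mathbf 1_S\big)$; and $\mathbb E\big(\sum_k\frac{n_k}n\tau_k\big)=\tau$ for $n\ge1$. * If $S$ depends only on $(H_i,W_i,X_i)_{i<n}$, with the same two provisos, then $\mathbb E(\hat\tau_{\text{Meta-SW}}\mathbf 1_S)=\mathbb E\big(\frac1n\sum_{i<n}X_i'(\theta^{(1)}-\theta^{(0)})\mathbf 1_S\big)$;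 and $\mathbb E\big(\frac1n\sum_{i<n}X_i'(\theta^{(1)}-\theta^{(0)})\big)=\tau$ for $n\ge1$. * If $\hat\tau_{\text{Meta-SW}}$ is integrable on the event of local full rank for all large $n$, then $\mathbb E(\hat\tau_{\text{Meta-SW}}\mid\text{local full rank})\to\tau$ as $n\to\infty$. -/

import Mathlib

open MeasureTheory ProbabilityTheory Filter Topology Finset Matrix

noncomputable section

namespace FedRCT

/-- An infinite sequence of units observed in `K` studies: covariates `X i`, treatment `W i`
(`true` = treated), potential outcomes `Y w i` and study membership `H i`. The sample of size `n`
consists of the units `i < n`. -/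
structure Units (Ω : Type*) (d K : ℕ) where
  X : ℕ → Ω → Fin d → ℝ
  W : ℕ → Ω → Bool
  Y : Bool → ℕ → Ω → ℝ
  H : ℕ → Ω → Fin K

variable {Ω : Type*} {d K : ℕ}

/-- The vector `(1, x)`. -/
def aug (x : Fin d → ℝ) : Fin (d + 1) → ℝ := Fin.cons 1 x

namespace Units

variable (D : Units Ω d K)

/-- Observed outcome, `Y = W Y(1) + (1 - W) Y(0)`. -/
def Yobs (i : ℕ) (ω : Ω) : ℝ := D.Y (D.W i ω) i ω

/-- Noise `ε(w) = Y(w) - c(w) - X β(w)`. -/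
def noise (c : Bool → ℝ) (β : Bool → Fin d → ℝ) (w : Bool) (i : ℕ) (ω : Ω) : ℝ :=
  D.Y w i ω - c w - D.X i ω ⬝ᵥ β w

/-! ### Subsamples -/

/-- Indices of the units of study `k`. -/
def studyIdx (n : ℕ) (k : Fin K) (ω : Ω) : Finset ℕ := {i ∈ range n | D.H i ω = k}

/-- Indices of the units of arm `w`. -/
def armIdx (n : ℕ) (w : Bool) (ω : Ω) : Finset ℕ := {i ∈ range n | D.W i ω = w}

/-- Indices of the units of arm `w` in study `k`. -/
def cellIdx (n : ℕ) (k : Fin K) (w : Bool) (ω : Ω) : Finset ℕ :=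
  {i ∈ range n | D.H i ω = k ∧ D.W i ω = w}

/-- The proportion `n_k / n`. -/
def studyFrac (n : ℕ) (k : Fin K) (ω : Ω) : ℝ := ((D.studyIdx n k ω).card : ℝ) / n

/-! ### Least squares -/

/-- `X'ᵀ X'` over the subsample `s`. -/
def gram (s : Finset ℕ) (ω : Ω) : Matrix (Fin (d + 1)) (Fin (d + 1)) ℝ :=
  ∑ i ∈ s, vecMulVec (aug (D.X i ω)) (aug (D.X i ω))

/-- Least squares coefficients `(X'ᵀ X')⁻¹ X'ᵀ Y` over the subsample `s`. -/
def ols (s : Finset ℕ) (ω : Ω) : Fin (d + 1) → ℝ :=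
  (D.gram s ω)⁻¹ *ᵥ ∑ i ∈ s, D.Yobs i ω • aug (D.X i ω)

/-- Every design matrix (with intercept) of one arm in one study has full column rank. -/
def LocalFullRank (n : ℕ) (ω : Ω) : Prop :=
  ∀ (k : Fin K) (w : Bool), (D.gram (D.cellIdx n k w ω) ω).rank = d + 1

/-- Plug-in G-formula: average over `s` of `X'ᵢ θ(1) - X'ᵢ θ(0)`. -/
def gFormula (s : Finset ℕ) (θ : Bool → Fin (d + 1) → ℝ) (ω : Ω) : ℝ :=
  (∑ i ∈ s, (aug (D.X i ω) ⬝ᵥ θ true - aug (D.X i ω) ⬝ᵥ θ false)) / (s.card : ℝ)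

/-- Study-wise G-formulas with common parameters `θ`, aggregated with weights `n_k / n`. -/
def federated (n : ℕ) (θ : Bool → Fin (d + 1) → ℝ) (ω : Ω) : ℝ :=
  ∑ k, D.studyFrac n k ω * D.gFormula (D.studyIdx n k ω) θ ω

/-! ### Pooled estimator -/

def tauPool (n : ℕ) (ω : Ω) : ℝ :=
  D.gFormula (range n) (fun w => D.ols (D.armIdx n w ω) ω) ω

/-! ### Meta-analysis with sample-size weights -/

/-- The local estimator in study `k`. -/
def tauLocal (n : ℕ) (k : Fin K) (ω : Ω) : ℝ :=
  D.gFormula (D.studyIdx n k ω) (fun w => D.ols (D.cellIdx n k w ω) ω) ω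

def tauMetaSW (n : ℕ) (ω : Ω) : ℝ := ∑ k, D.studyFrac n k ω * D.tauLocal n k ω

/-! ### One-shot federation with inverse variance weights -/

/-- Variance matrix of the local least squares coefficients given the design,
`σ² (X'ᵀ X')⁻¹`. -/
def localVar (σ : ℝ) (n : ℕ) (k : Fin K) (w : Bool) (ω : Ω) :
    Matrix (Fin (d + 1)) (Fin (d + 1)) ℝ :=
  σ ^ 2 • (D.gram (D.cellIdx n k w ω) ω)⁻¹

/-- Inverse variance weighted average of the local coefficients. -/
def thetaIVW (σ : ℝ) (n : ℕ) (ω : Ω) (w : Bool) : Fin (d + 1) → ℝ :=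
  (∑ k, (D.localVar σ n k w ω)⁻¹)⁻¹ *ᵥ
    ∑ k, (D.localVar σ n k w ω)⁻¹ *ᵥ D.ols (D.cellIdx n k w ω) ω

def tauIVW (σ : ℝ) (n : ℕ) (ω : Ω) : ℝ := D.federated n (D.thetaIVW σ n ω) ω

/-! ### Federated gradient descent (FedAvg) -/

/-- Gradient of the mean squared error over the (full) batch `s`. -/
def lossGrad (s : Finset ℕ) (ω : Ω) (θ : Fin (d + 1) → ℝ) : Fin (d + 1) → ℝ :=
  -(2 / (s.card : ℝ)) • ∑ i ∈ s, (D.Yobs i ω - aug (D.X i ω) ⬝ᵥ θ) • aug (D.X i ω)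

/-- `E` local full-batch gradient steps with learning rate `η`. -/
def localUpdate (s : Finset ℕ) (ω : Ω) (η : ℝ) (E : ℕ) (θ : Fin (d + 1) → ℝ) :
    Fin (d + 1) → ℝ :=
  (fun θ' => θ' - η • D.lossGrad s ω θ')^[E] θ

/-- One communication round for arm `w`: local updates, then averaging with weights
`n_k(w) / n(w)`. -/
def fedAvgRound (n : ℕ) (w : Bool) (ω : Ω) (η : ℝ) (E : ℕ) (θ : Fin (d + 1) → ℝ) :
    Fin (d + 1) → ℝ :=
  ∑ k, (((D.cellIdx n k w ω).card : ℝ) / ((D.armIdx n w ω).card : ℝ)) •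
    D.localUpdate (D.cellIdx n k w ω) ω η E θ

/-- FedAvg after `T` rounds, started at `θ₀`. -/
def fedAvg (n : ℕ) (w : Bool) (ω : Ω) (η : ℝ) (E T : ℕ) (θ₀ : Fin (d + 1) → ℝ) :
    Fin (d + 1) → ℝ :=
  (D.fedAvgRound n w ω η E)^[T] θ₀

/-- FedAvg with one local step per round, run to convergence. -/
def thetaGD (η : ℕ → Bool → Ω → ℝ) (θ₀ : Bool → Fin (d + 1) → ℝ) (n : ℕ) (ω : Ω) (w : Bool) :
    Fin (d + 1) → ℝ :=
  limUnder atTop (fun T : ℕ => D.fedAvg n w ω (η n w ω) 1 T (θ₀ w))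

def tauGD (η : ℕ → Bool → Ω → ℝ) (θ₀ : Bool → Fin (d + 1) → ℝ) (n : ℕ) (ω : Ω) : ℝ :=
  D.federated n (D.thetaGD η θ₀ n ω) ω

/-- Hessian of the pooled mean squared error of arm `w`. -/
def lossHess (n : ℕ) (w : Bool) (ω : Ω) : Matrix (Fin (d + 1)) (Fin (d + 1)) ℝ :=
  (2 / ((D.armIdx n w ω).card : ℝ)) • D.gram (D.armIdx n w ω) ω

/-- The learning rates satisfy `0 < η < 2 / L`, where `L` is the smoothness constant (largest
eigenvalue of the Hessian) of the pooled loss; that is, `2 I - η • Hessian` is positive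
definite. They may depend on the data. -/
def IsLearningRate [MeasurableSpace Ω] (η : ℕ → Bool → Ω → ℝ) : Prop :=
  (∀ n w, Measurable (η n w)) ∧ ∀ n w ω, 0 < η n w ω ∧
    ((2 : ℝ) • (1 : Matrix (Fin (d + 1)) (Fin (d + 1)) ℝ) - η n w ω • D.lossHess n w ω).PosDef

/-! ### Population quantities -/

variable [MeasurableSpace Ω] (P : Measure Ω)

/-- The law of the experiment given that a unit belongs to study `k`. -/
def studyMeasure (k : Fin K) : Measure Ω := P[|D.H 0 ⁻¹' {k}]

/-- `ρ_k = P(H = k)`. -/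
def rho (k : Fin K) : ℝ := P.real (D.H 0 ⁻¹' {k})

/-- `p_k = P(W = 1 | H = k)`. -/
def treatProb (k : Fin K) : ℝ := (D.studyMeasure P k).real (D.W 0 ⁻¹' {true})

/-- `Σ_k = V(X | H = k)`. -/
def covStudy (k : Fin K) : Matrix (Fin d) (Fin d) ℝ :=
  Matrix.of fun a b => cov[fun ω => D.X 0 ω a, fun ω => D.X 0 ω b; D.studyMeasure P k]

/-- The average treatment effect `τ = E(Y(1) - Y(0))`. -/
def tau : ℝ := ∫ ω, (D.Y true 0 ω - D.Y false 0 ω) ∂P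

/-- The average treatment effect `τ_k = E(Y(1) - Y(0) | H = k)` in study `k`. -/
def tauStudy (k : Fin K) : ℝ := ∫ ω, (D.Y true 0 ω - D.Y false 0 ω) ∂(D.studyMeasure P k)

/-- `∑_k (n_k / n) τ_k`. -/
def tauGivenH (n : ℕ) (ω : Ω) : ℝ := ∑ k, D.studyFrac n k ω * D.tauStudy P k

/-- `σ² ∑_k ρ_k / (p_k (1 - p_k)) + ‖β(1) - β(0)‖²_Σ` with `Σ = ∑_k ρ_k Σ_k`. -/
def metaVar (β : Bool → Fin d → ℝ) (σ : ℝ) : ℝ :=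
  σ ^ 2 * ∑ k, D.rho P k / (D.treatProb P k * (1 - D.treatProb P k)) +
    (β true - β false) ⬝ᵥ ((∑ k, D.rho P k • D.covStudy P k) *ᵥ (β true - β false))

/-- Between-study variance `∑_k ρ_k (τ_k - τ)²` of the study-level effects. -/
def betweenVar : ℝ := ∑ k, D.rho P k * (D.tauStudy P k - D.tau P) ^ 2

/-- Average over the first `n` units of the effect `X'ᵢ (θ(1) - θ(0))`, `θ(w) = (c(w), β(w))`. -/
def sampleEffect (c : Bool → ℝ) (β : Bool → Fin d → ℝ) (n : ℕ) (ω : Ω) : ℝ :=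
  D.gFormula (range n) (fun w => Fin.cons (c w) (β w)) ω

/-- The σ-algebra of the memberships and treatments of the first `n` units. -/
@[reducible]
def assignmentSigma (n : ℕ) : MeasurableSpace Ω :=
  MeasurableSpace.comap (fun ω (i : Fin n) => (D.H i ω, D.W i ω)) inferInstance

/-- The σ-algebra of the memberships, treatments and covariates of the first `n` units. -/
@[reducible]
def designSigma (n : ℕ) : MeasurableSpace Ω :=
  MeasurableSpace.comap (fun ω (i : Fin n) => (D.H i ω, D.W i ω, D.X i ω)) inferInstance

/-- `K` Bernoulli randomised trials with a common linear outcome model and covariate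
distributions that may differ between the studies (as may the treatment probabilities). -/
structure IsCovariateShiftModel (c : Bool → ℝ) (β : Bool → Fin d → ℝ) (σ : ℝ) : Prop where
  measurable_X : ∀ i, Measurable (D.X i)
  measurable_W : ∀ i, Measurable (D.W i)
  measurable_Y : ∀ w i, Measurable (D.Y w i)
  measurable_H : ∀ i, Measurable (D.H i)
  /-- The units are independent ... -/
  indep : iIndepFun
    (fun i ω => (D.X i ω, D.W i ω, D.Y false i ω, D.Y true i ω, D.H i ω)) P
  /-- ... and identically distributed. -/
  identDistrib : ∀ i, IdentDistrib
    (fun ω => (D.X i ω, D.W i ω, D.Y false i ω, D.Y true i ω, D.H i ω))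
    (fun ω => (D.X 0 ω, D.W 0 ω, D.Y false 0 ω, D.Y true 0 ω, D.H 0 ω)) P P
  rho_pos : ∀ k, 0 < D.rho P k
  treatProb_pos : ∀ k, 0 < D.treatProb P k
  treatProb_lt_one : ∀ k, D.treatProb P k < 1
  /-- Treatment is randomised within each study. -/
  randomized : ∀ k, IndepFun (D.W 0) (fun ω => (D.X 0 ω, D.Y false 0 ω, D.Y true 0 ω))
    (D.studyMeasure P k)
  memLp_X : MemLp (D.X 0) 2 P
  /-- The covariates are not degenerate within any study. -/
  posDef : ∀ k, (D.covStudy P k).PosDef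
  sigma_pos : 0 < σ
  memLp_noise : ∀ w, MemLp (D.noise c β w 0) 2 P
  /-- `E(ε(w) | X, H) = 0`. -/
  noise_mean : ∀ w,
    P[D.noise c β w 0 | MeasurableSpace.comap (fun ω => (D.X 0 ω, D.H 0 ω)) inferInstance]
      =ᵐ[P] fun _ => 0
  /-- `V(ε(w) | X, H) = σ²`. -/
  noise_var : ∀ w,
    P[fun ω => D.noise c β w 0 ω ^ 2 |
        MeasurableSpace.comap (fun ω => (D.X 0 ω, D.H 0 ω)) inferInstance]
      =ᵐ[P] fun _ => σ ^ 2

end Units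

/-- `√n (T n - C n)` converges in distribution to the centred normal law of variance `v`: the
asymptotic variance of the estimator `T` about `C` is `v`. -/
def HasAsympVar [MeasurableSpace Ω] (P : Measure Ω) [IsProbabilityMeasure P]
    (T C : ℕ → Ω → ℝ) (v : ℝ) : Prop :=
  0 ≤ v ∧ TendstoInDistribution (fun (n : ℕ) ω => √(n : ℝ) * (T n ω - C n ω)) atTop
    (id : ℝ → ℝ) (fun _ => P) (gaussianReal 0 v.toNNReal)

end FedRCT

end

/-!
Given the features `(H, W, X)` of the units, the residuals `ε` are centred with variance `σ²`. On
the event of local full rank, which holds eventually almost surely, every least squares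
coefficient is the true one plus a linear combination of residuals, so each estimator is the
sample mean of the effects `X' (θ(1) - θ(0))` plus `n⁻¹ ∑ aᵢ εᵢ` with coefficients `aᵢ` depending
on the features only. On the same event the 1S-IVW and FedAvg coefficients are the pooled ones:
inverse variance weighting adds up the local normal equations, and one-step FedAvg is gradient
descent on the pooled loss, a contraction towards its minimiser.

Unbiasedness of Meta-SW follows because the residuals are centred given the design. For the
asymptotic variances, the weights `aᵢ` may be replaced by their limits `v(Hᵢ, Wᵢ) ⬝ᵥ X'ᵢ`, and the
central limit theorem gives the variance of the effect plus `σ² E (v ⬝ᵥ X')²`. The normal equations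
show that the limiting weights `u` of the pooled and `m` of the Meta-SW estimator satisfy
`E (u m) = E (u²)`, whence `E (u²) ≤ E (m²)`, as in the Gauss–Markov theorem.
-/

noncomputable section

namespace FedRCT

section AsymptoticLinearity

variable {Ω : Type*} [MeasurableSpace Ω] {P : Measure Ω}

lemma tendstoInMeasure_zero_mul_of_integral_sq_le [IsFiniteMeasure P] {A B : ℕ → Ω → ℝ} {C : ℝ}
    (hA : TendstoInMeasure P A atTop 0) (hB : ∀ n, MemLp (B n) 2 P)
    (hC : ∀ n, ∫ ω, B n ω ^ 2 ∂P ≤ C) :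
    TendstoInMeasure P (fun n ω => A n ω * B n ω) atTop 0 := by
  rw [tendstoInMeasure_iff_measureReal_norm] at *
  intro ε hε
  have split_bound (R : ℝ) (hR : 0 < R) (n : ℕ) :
      P.real {ω | ε ≤ ‖A n ω * B n ω - (0 : Ω → ℝ) ω‖} ≤
        P.real {ω | ε / R ≤ ‖A n ω - (0 : Ω → ℝ) ω‖} + C / R ^ 2 := by
    have chebyshev : P.real {ω | R ^ 2 ≤ B n ω ^ 2} ≤ C / R ^ 2 := by
      rw [le_div_iff₀' (by positivity)]
      exact (mul_meas_ge_le_integral_of_nonneg (Eventually.of_forall fun _ => sq_nonneg _)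
        (hB n).integrable_sq _).trans (hC n)
    refine ((measureReal_mono fun ω hω => ?_).trans (measureReal_union_le _ _)).trans
      (add_le_add_right chebyshev _)
    simp only [Set.mem_ofPred_eq, Pi.zero_apply, sub_zero, Set.mem_union, norm_mul] at hω ⊢
    by_contra! ⟨hAω, hBω⟩
    have hBR : ‖B n ω‖ < R := abs_lt_of_sq_lt_sq hBω hR.le
    have := mul_lt_mul'' hAω hBR (norm_nonneg _) (norm_nonneg _)
    rw [div_mul_cancel₀ _ hR.ne'] at this
    exact this.not_ge hω
  rw [Metric.tendsto_atTop]
  intro δ hδ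
  obtain ⟨R, hCR, hR⟩ : ∃ R : ℝ, C / R ^ 2 < δ / 2 ∧ 0 < R :=
    (((tendsto_const_nhds.div_atTop (tendsto_pow_atTop two_ne_zero)).eventually_lt_const
      (half_pos hδ)).and (eventually_gt_atTop 0)).exists
  obtain ⟨N, hN⟩ := eventually_atTop.1 <|
    (hA (ε / R) (div_pos hε hR)).eventually_lt_const (half_pos hδ)
  refine ⟨N, fun n hn => ?_⟩
  rw [Real.dist_0_eq_abs, abs_of_nonneg measureReal_nonneg]
  linarith [split_bound R hR n, hN n hn]

/-- A sequence of independent, identically distributed, centred, square integrable random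
variables. -/
structure IsCenteredIID (P : Measure Ω) (X : ℕ → Ω → ℝ) : Prop where
  indep : iIndepFun X P
  identDistrib : ∀ i, IdentDistrib (X i) (X 0) P P
  memLp_zero : MemLp (X 0) 2 P
  integral_zero : ∫ ω, X 0 ω ∂P = 0

namespace IsCenteredIID

variable {X : ℕ → Ω → ℝ}

lemma memLp (hX : IsCenteredIID P X) (i : ℕ) : MemLp (X i) 2 P :=
  (hX.identDistrib i).memLp_iff.2 hX.memLp_zero

lemma integral_eq_zero (hX : IsCenteredIID P X) (i : ℕ) : ∫ ω, X i ω ∂P = 0 :=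
  (hX.identDistrib i).integral_eq.trans hX.integral_zero

lemma integral_sq_sum [IsProbabilityMeasure P] (hX : IsCenteredIID P X) (n : ℕ) :
    ∫ ω, (∑ i ∈ range n, X i ω) ^ 2 ∂P = n * ∫ ω, X 0 ω ^ 2 ∂P := by
  have variance_eq {Y : Ω → ℝ} (hY : MemLp Y 2 P) (h0 : ∫ ω, Y ω ∂P = 0) :
      ∫ ω, Y ω ^ 2 ∂P = Var[Y; P] :=
    (variance_of_integral_eq_zero hY.aestronglyMeasurable.aemeasurable h0).symm
  have mean_sum : ∫ ω, ∑ i ∈ range n, X i ω ∂P = 0 := by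
    rw [integral_finsetSum _ fun i _ => (hX.memLp i).integrable one_le_two]
    exact Finset.sum_eq_zero fun i _ => hX.integral_eq_zero i
  have variance_sum : Var[∑ i ∈ range n, X i; P] = n * Var[X 0; P] := by
    rw [IndepFun.variance_sum (fun i _ => hX.memLp i)
      fun i _ j _ hij => hX.indep.indepFun hij]
    simp [fun i => (hX.identDistrib i).variance_eq]
  rw [variance_eq hX.memLp_zero hX.integral_zero, ← variance_sum,
    variance_eq (memLp_finsetSum _ fun i _ => hX.memLp i) mean_sum]
  congr 1
  ext ω
  simp

lemma memLp_inv_sqrt_mul_sum (hX : IsCenteredIID P X) (n : ℕ) :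
    MemLp (fun ω => (√(n : ℝ))⁻¹ * ∑ i ∈ range n, X i ω) 2 P :=
  (memLp_finsetSum _ fun i _ => hX.memLp i).const_mul _

lemma integral_sq_inv_sqrt_mul_sum_le [IsProbabilityMeasure P] (hX : IsCenteredIID P X) (n : ℕ) :
    ∫ ω, ((√(n : ℝ))⁻¹ * ∑ i ∈ range n, X i ω) ^ 2 ∂P ≤ ∫ ω, X 0 ω ^ 2 ∂P := by
  simp only [mul_pow, inv_pow, Real.sq_sqrt (Nat.cast_nonneg n)]
  rw [integral_const_mul, hX.integral_sq_sum, ← mul_assoc]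
  exact mul_le_of_le_one_left (integral_nonneg fun _ => sq_nonneg _) inv_mul_le_one

lemma tendstoInDistribution [IsProbabilityMeasure P] (hX : IsCenteredIID P X) :
    TendstoInDistribution (fun (n : ℕ) ω => (√(n : ℝ))⁻¹ * ∑ i ∈ range n, X i ω) atTop
      (id : ℝ → ℝ) (fun _ => P) (gaussianReal 0 Var[X 0; P].toNNReal) := by
  simpa only [hX.integral_zero, mul_zero, sub_zero] using
    tendstoInDistribution_inv_sqrt_mul_sum_sub HasLaw.id hX.memLp_zero hX.indep hX.identDistrib

end IsCenteredIID

lemma tendstoInDistribution_add_sum_of_tendstoInMeasure_zero [IsProbabilityMeasure P]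
    {Ω' ι : Type*} [MeasurableSpace Ω'] {Q : Measure Ω'} [IsProbabilityMeasure Q]
    {X : ℕ → Ω → ℝ} {Z : Ω' → ℝ} {R : ι → ℕ → Ω → ℝ}
    (hX : TendstoInDistribution X atTop Z (fun _ => P) Q) (s : Finset ι)
    (hR : ∀ a ∈ s, TendstoInMeasure P (R a) atTop 0)
    (hRm : ∀ a ∈ s, ∀ n, AEMeasurable (R a n) P) :
    TendstoInDistribution (fun n ω => X n ω + ∑ a ∈ s, R a n ω) atTop Z (fun _ => P) Q := by
  classical
  induction s using Finset.induction_on with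
  | empty => simpa using hX
  | insert a s ha ih =>
    have slutsky := (ih (fun b hb => hR b (mem_insert_of_mem hb))
      (fun b hb => hRm b (mem_insert_of_mem hb))).add_of_tendstoInMeasure_const (c := (0 : ℝ))
      (hR a (mem_insert_self a s)) (hRm a (mem_insert_self a s))
    simp only [add_zero] at slutsky
    convert slutsky using 3 with n
    rw [sum_insert ha, Pi.add_apply]
    ring

theorem hasAsympVar_of_asymptoticallyLinear [IsProbabilityMeasure P] {ι : Type*} [Fintype ι]
    {X : ℕ → Ω → ℝ} (hX : IsCenteredIID P X)
    {Y : ι → ℕ → Ω → ℝ} (hY : ∀ a, IsCenteredIID P (Y a))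
    {A : ι → ℕ → Ω → ℝ} (hAm : ∀ a n, AEStronglyMeasurable (A a n) P)
    (hA : ∀ a, ∀ᵐ ω ∂P, Tendsto (fun n => A a n ω) atTop (𝓝 0))
    {T C : ℕ → Ω → ℝ} (hTC : ∀ n, AEMeasurable (fun ω => T n ω - C n ω) P)
    (h : ∀ᵐ ω ∂P, ∀ᶠ n : ℕ in atTop, T n ω - C n ω = (∑ i ∈ range n, X i ω) / n +
      ∑ a, A a n ω * ((∑ i ∈ range n, Y a i ω) / n)) :
    HasAsympVar P T C Var[X 0; P] := by
  refine ⟨variance_nonneg _ _, ?_⟩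
  set B : ι → ℕ → Ω → ℝ := fun a n ω => (√(n : ℝ))⁻¹ * ∑ i ∈ range n, Y a i ω with hB
  have product_negligible (a : ι) : TendstoInMeasure P (fun n ω => A a n ω * B a n ω) atTop 0 :=
    tendstoInMeasure_zero_mul_of_integral_sq_le (tendstoInMeasure_of_tendsto_ae (hAm a) (hA a))
      (hY a).memLp_inv_sqrt_mul_sum (hY a).integral_sq_inv_sqrt_mul_sum_le
  have product_measurable (a : ι) (n : ℕ) : AEMeasurable (fun ω => A a n ω * B a n ω) P :=
    (hAm a n).aemeasurable.mul ((hY a).memLp_inv_sqrt_mul_sum n).aestronglyMeasurable.aemeasurable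
  have linear_part := tendstoInDistribution_add_sum_of_tendstoInMeasure_zero
    hX.tendstoInDistribution univ (fun a _ => product_negligible a)
    (fun a _ => product_measurable a)
  have hTC' (n : ℕ) : AEMeasurable (fun ω => √(n : ℝ) * (T n ω - C n ω)) P := (hTC n).const_mul _
  refine tendstoInDistribution_of_tendstoInMeasure_sub _ _ linear_part
    (tendstoInMeasure_of_tendsto_ae (fun n => ((hTC' n).sub
      (linear_part.forall_aemeasurable n)).aestronglyMeasurable) ?_) hTC'
  filter_upwards [h] with ω hω
  refine tendsto_const_nhds.congr' ?_
  filter_upwards [hω] with n hn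
  have sqrt_mul_div (S : ℝ) : √(n : ℝ) * (S / n) = (√(n : ℝ))⁻¹ * S := by
    rw [← Real.sqrt_div_self]; ring
  simp only [hn, hB, Pi.sub_apply, Pi.zero_apply, mul_add, Finset.mul_sum, mul_left_comm (√_),
    sqrt_mul_div, sub_self]

end AsymptoticLinearity

section ConditionalMoments

variable {Ω E F : Type*} [MeasurableSpace Ω] [MeasurableSpace E] [MeasurableSpace F]
  {P : Measure Ω}

lemma integral_sq_le_integral_sq_of_integral_mul_eq {f g : Ω → ℝ} (hf : MemLp f 2 P)
    (hg : MemLp g 2 P) (h : ∫ ω, f ω * g ω ∂P = ∫ ω, f ω ^ 2 ∂P) :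
    ∫ ω, f ω ^ 2 ∂P ≤ ∫ ω, g ω ^ 2 ∂P := by
  have hfg : Integrable (fun ω => f ω * g ω) P := hf.integrable_mul hg
  calc ∫ ω, f ω ^ 2 ∂P = ∫ ω, (2 * (f ω * g ω) - f ω ^ 2) ∂P := by
        rw [integral_sub (hfg.const_mul 2) hf.integrable_sq, integral_const_mul, h]
        ring
    _ ≤ ∫ ω, g ω ^ 2 ∂P :=
        integral_mono ((hfg.const_mul 2).sub hf.integrable_sq) hg.integrable_sq fun ω => by
          linarith [sq_nonneg (g ω - f ω)]

lemma setIntegral_preimage_prodMk_eq_zero_of_indepFun [IsProbabilityMeasure P]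
    {X : Ω → E} {U : Ω → F} {r : Ω → ℝ} (hX : Measurable X) (hU : Measurable U)
    (hr : Measurable r) (hri : Integrable r P) (hXU : IndepFun (fun ω => (X ω, r ω)) U P)
    (h0 : ∀ B, MeasurableSet B → ∫ ω in X ⁻¹' B, r ω ∂P = 0) {C : Set (E × F)}
    (hC : MeasurableSet C) : ∫ ω in (fun ω => (X ω, U ω)) ⁻¹' C, r ω ∂P = 0 := by
  have hXUm : Measurable fun ω => (X ω, U ω) := hX.prodMk hU
  induction C, hC using MeasurableSpace.induction_on_inter generateFrom_prod.symm
    isPiSystem_prod with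
  | empty => simp
  | basic C hC =>
    obtain ⟨B, hB, G, hG, rfl⟩ := hC
    have factor := Indep.setIntegral_eq_mul (hU.comap_le) hXU.symm (hX.prodMk hr).aemeasurable
      ⟨G, hG, rfl⟩ (f := (Prod.fst ⁻¹' B).indicator Prod.snd)
      (measurable_snd.indicator (measurable_fst hB)).aestronglyMeasurable
    calc ∫ ω in (fun ω => (X ω, U ω)) ⁻¹' B ×ˢ G, r ω ∂P
        = ∫ ω in U ⁻¹' G, (X ⁻¹' B).indicator r ω ∂P := by
          rw [setIntegral_indicator (hX hB), Set.mk_preimage_prod, Set.inter_comm]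
      _ = P.real (U ⁻¹' G) * ∫ ω, (X ⁻¹' B).indicator r ω ∂P := factor
      _ = 0 := by rw [integral_indicator (hX hB), h0 B hB, mul_zero]
  | compl C hC ih =>
    rw [Set.preimage_compl, setIntegral_compl (hXUm hC) hri, ih, sub_zero]
    simpa using h0 Set.univ MeasurableSet.univ
  | iUnion C hdisj hC ih =>
    rw [Set.preimage_iUnion, integral_iUnion (fun i => hXUm (hC i))
      (fun i j hij => (hdisj hij).preimage _) hri.integrableOn]
    simp [ih]

lemma setIntegral_eq_zero_of_iIndepFun [IsProbabilityMeasure P] {G : Type*} [MeasurableSpace G]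
    {n : ℕ} {Z : Fin n → Ω → E} (hZ : ∀ i, Measurable (Z i)) (hind : iIndepFun Z P) {f : E → G}
    (hf : Measurable f) {r : E → ℝ} (hr : Measurable r) {i : Fin n}
    (hri : Integrable (fun ω => r (Z i ω)) P)
    (h0 : ∀ B, MeasurableSet B → ∫ ω in (fun ω => f (Z i ω)) ⁻¹' B, r (Z i ω) ∂P = 0)
    {S : Set Ω}
    (hS : MeasurableSet[MeasurableSpace.comap (fun ω j => f (Z j ω)) inferInstance] S) :
    ∫ ω in S, r (Z i ω) ∂P = 0 := by
  obtain ⟨B, hB, rfl⟩ := hS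
  cases n with
  | zero => exact i.elim0
  | succ n =>
    have hind_others : IndepFun (fun ω => (f (Z i ω), r (Z i ω)))
        (fun ω j => f (Z (i.succAbove j) ω)) P :=
      (hind.indepFun_finset {i} {i}ᶜ disjoint_compl_right hZ).comp
        (φ := fun x : ({i} : Finset (Fin (n + 1))) → E =>
          (f (x ⟨i, mem_singleton_self i⟩), r (x ⟨i, mem_singleton_self i⟩)))
        (ψ := fun (x : ({i}ᶜ : Finset (Fin (n + 1))) → E) j =>
          f (x ⟨i.succAbove j, by simp [Fin.succAbove_ne]⟩))
        (by fun_prop) (by fun_prop)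
    have hsplit (ω : Ω) : (MeasurableEquiv.piFinSuccAbove (fun _ => G) i).symm
        (f (Z i ω), fun j => f (Z (i.succAbove j) ω)) = fun j => f (Z j ω) :=
      (MeasurableEquiv.symm_apply_eq _).2 rfl
    have hzero := setIntegral_preimage_prodMk_eq_zero_of_indepFun (hf.comp (hZ i))
      (measurable_pi_lambda _ fun j => hf.comp (hZ (i.succAbove j))) (hr.comp (hZ i)) hri
      hind_others h0 ((MeasurableEquiv.piFinSuccAbove (fun _ => G) i).symm.measurable hB)
    simpa only [Set.preimage_preimage, Function.comp_apply, hsplit] using hzero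

variable {Z : Ω → E} {r : Ω → ℝ} {v : ℝ} {u : E → ℝ}

lemma map_withDensity_ofReal_eq_smul_map [IsFiniteMeasure P] (hZ : Measurable Z)
    (hr : Integrable r P) (hr0 : 0 ≤ r) (hv : 0 ≤ v)
    (h : ∀ B, MeasurableSet B → ∫ ω in Z ⁻¹' B, r ω ∂P = v * P.real (Z ⁻¹' B)) :
    (P.withDensity fun ω => ENNReal.ofReal (r ω)).map Z = ENNReal.ofReal v • P.map Z := by
  ext B hB
  rw [Measure.map_apply hZ hB, withDensity_apply _ (hZ hB), Measure.smul_apply,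
    Measure.map_apply hZ hB, ← ofReal_integral_eq_lintegral_ofReal hr.integrableOn
      (Eventually.of_forall hr0), h B hB, ENNReal.ofReal_mul hv, ofReal_measureReal, smul_eq_mul]

lemma integrable_comp_mul_of_setIntegral_preimage_eq [IsFiniteMeasure P] (hZ : Measurable Z)
    (hrm : Measurable r) (hr : Integrable r P) (hr0 : 0 ≤ r) (hv : 0 ≤ v)
    (h : ∀ B, MeasurableSet B → ∫ ω in Z ⁻¹' B, r ω ∂P = v * P.real (Z ⁻¹' B))
    (hu : Measurable u) (huZ : Integrable (fun ω => u (Z ω)) P) :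
    Integrable (fun ω => u (Z ω) * r ω) P := by
  have integrable_map : Integrable u ((P.withDensity fun ω => ENNReal.ofReal (r ω)).map Z) := by
    rw [map_withDensity_ofReal_eq_smul_map hZ hr hr0 hv h]
    exact ((integrable_map_measure hu.aestronglyMeasurable hZ.aemeasurable).2 huZ).smul_measure
      ENNReal.ofReal_ne_top
  have := (integrable_map_measure hu.aestronglyMeasurable hZ.aemeasurable).1 integrable_map
  rw [integrable_withDensity_iff hrm.ennreal_ofReal
    (Eventually.of_forall fun _ => ENNReal.ofReal_lt_top)] at this
  simpa only [Function.comp_apply, ENNReal.toReal_ofReal (hr0 _)] using this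

lemma integral_comp_mul_of_setIntegral_preimage_eq [IsFiniteMeasure P] (hZ : Measurable Z)
    (hrm : Measurable r) (hr : Integrable r P) (hr0 : 0 ≤ r) (hv : 0 ≤ v)
    (h : ∀ B, MeasurableSet B → ∫ ω in Z ⁻¹' B, r ω ∂P = v * P.real (Z ⁻¹' B))
    (hu : Measurable u) : ∫ ω, u (Z ω) * r ω ∂P = v * ∫ ω, u (Z ω) ∂P := by
  have change_measure := integral_map (μ := P.withDensity fun ω => ENNReal.ofReal (r ω))
    hZ.aemeasurable hu.aestronglyMeasurable
  rw [map_withDensity_ofReal_eq_smul_map hZ hr hr0 hv h, integral_smul_measure,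
    integral_map hZ.aemeasurable hu.aestronglyMeasurable,
    integral_withDensity_eq_integral_toReal_smul hrm.ennreal_ofReal
      (Eventually.of_forall fun _ => ENNReal.ofReal_lt_top)] at change_measure
  simpa only [ENNReal.toReal_ofReal (hr0 _), ENNReal.toReal_ofReal hv, smul_eq_mul, mul_comm (r _)]
    using change_measure.symm

end ConditionalMoments

section CenteredGivenSigmaAlgebra

variable {Ω : Type*} {m mΩ : MeasurableSpace Ω} {P : Measure Ω} [IsFiniteMeasure P] (hm : m ≤ mΩ)
include hm

lemma integral_mul_eq_zero_of_setIntegral_eq_zero {a r : Ω → ℝ} (ha : Measurable[m] a)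
    (hr : Integrable r P) (h0 : ∀ S, MeasurableSet[m] S → ∫ ω in S, r ω ∂P = 0)
    (har : Integrable (fun ω => a ω * r ω) P) : ∫ ω, a ω * r ω ∂P = 0 := by
  have condExp_r : (fun _ => (0 : ℝ)) =ᵐ[P] P[r | m] := by
    refine ae_eq_condExp_of_forall_setIntegral_eq hm hr
      (fun _ _ _ => integrableOn_const) (fun S hS _ => ?_) aestronglyMeasurable_const
    rw [h0 S hS, integral_zero]
  have pull_out := condExp_mul_of_stronglyMeasurable_left (μ := P) ha.stronglyMeasurable har hr
  rw [← integral_condExp hm]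
  refine integral_eq_zero_of_ae (pull_out.trans ?_)
  filter_upwards [condExp_r] with ω hω
  rw [Pi.mul_apply, ← hω, mul_zero, Pi.zero_apply]

lemma setIntegral_mul_eq_zero_of_setIntegral_eq_zero {a r : Ω → ℝ} (ha : Measurable[m] a)
    (hr : Integrable r P) (h0 : ∀ S, MeasurableSet[m] S → ∫ ω in S, r ω ∂P = 0) {S : Set Ω}
    (hS : MeasurableSet[m] S) (har : IntegrableOn (fun ω => a ω * r ω) S P) :
    ∫ ω in S, a ω * r ω ∂P = 0 := by
  have restrict_left : S.indicator (fun ω => a ω * r ω) = fun ω => S.indicator a ω * r ω :=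
    funext fun ω => Set.indicator_mul_left S a r
  rw [← integral_indicator (hm _ hS), restrict_left]
  refine integral_mul_eq_zero_of_setIntegral_eq_zero hm (ha.indicator hS) hr h0 ?_
  rw [← restrict_left]
  exact har.integrable_indicator (hm _ hS)

/-- Only the sum is assumed to be integrable, so that the integral is the limit of the integrals
over the sets on which the coefficients are bounded by `N`, where the terms can be separated. -/
lemma setIntegral_sum_mul_eq_zero_of_setIntegral_eq_zero {ι : Type*} {s : Finset ι}
    {a r : ι → Ω → ℝ} (ha : ∀ i ∈ s, Measurable[m] (a i)) (hr : ∀ i ∈ s, Integrable (r i) P)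
    (h0 : ∀ i ∈ s, ∀ S, MeasurableSet[m] S → ∫ ω in S, r i ω ∂P = 0) {S : Set Ω}
    (hS : MeasurableSet[m] S) (har : IntegrableOn (fun ω => ∑ i ∈ s, a i ω * r i ω) S P) :
    ∫ ω in S, ∑ i ∈ s, a i ω * r i ω ∂P = 0 := by
  let U (N : ℕ) : Set Ω := S ∩ {ω | ∑ i ∈ s, |a i ω| ≤ N}
  have measurableSet_U (N : ℕ) : MeasurableSet[m] (U N) := by
    have measurable_bound : Measurable[m] fun ω => ∑ i ∈ s, |a i ω| :=
      Finset.measurable_sum _ fun i hi => measurable_norm.comp (ha i hi)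
    exact hS.inter (measurable_bound measurableSet_Iic)
  have monotone_U : Monotone U := fun M N hMN ω hω =>
    ⟨hω.1, le_trans (α := ℝ) hω.2 (Nat.cast_le.2 hMN)⟩
  have iUnion_U : ⋃ N, U N = S := by
    rw [← Set.inter_iUnion, Set.inter_eq_left]
    exact fun ω _ => Set.mem_iUnion.2 (exists_nat_ge (∑ i ∈ s, |a i ω|))
  have integral_U (N : ℕ) : ∫ ω in U N, ∑ i ∈ s, a i ω * r i ω ∂P = 0 := by
    have integrableOn_term (i : ι) (hi : i ∈ s) :
        IntegrableOn (fun ω => a i ω * r i ω) (U N) P := by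
      refine (hr i hi).integrableOn.bdd_mul (c := N)
        ((ha i hi).mono hm le_rfl).aestronglyMeasurable
        (ae_restrict_of_forall_mem (hm _ (measurableSet_U N)) fun ω hω => ?_)
      exact (single_le_sum (f := fun i => |a i ω|) (fun _ _ => abs_nonneg _) hi).trans hω.2
    rw [integral_finsetSum _ integrableOn_term]
    exact sum_eq_zero fun i hi => setIntegral_mul_eq_zero_of_setIntegral_eq_zero hm (ha i hi)
      (hr i hi) (h0 i hi) (measurableSet_U N) (integrableOn_term i hi)
  have tendsto_integral := tendsto_setIntegral_of_monotone (fun N => hm _ (measurableSet_U N))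
    monotone_U (iUnion_U.symm ▸ har)
  simp only [integral_U, iUnion_U] at tendsto_integral
  exact tendsto_nhds_unique tendsto_integral tendsto_const_nhds

end CenteredGivenSigmaAlgebra

section Matrices

open scoped ComplexOrder

variable {m 𝕜 : Type*} [Fintype m]

lemma abs_eigenvalues_lt_one_of_posDef [DecidableEq m] [RCLike 𝕜] {A : Matrix m m 𝕜}
    (hA : A.IsHermitian) (hsub : (1 - A).PosDef) (hadd : (1 + A).PosDef) (i : m) :
    |hA.eigenvalues i| < 1 := by
  set v : m → 𝕜 := ⇑(hA.eigenvectorBasis i)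
  have hv : v ≠ 0 := fun h =>
    hA.eigenvectorBasis.orthonormal.ne_zero i (PiLp.ext fun j => congrFun h j)
  have hvv : star v ⬝ᵥ v = 1 := by
    rw [dotProduct_comm, ← EuclideanSpace.inner_eq_star_dotProduct]
    simp
  have hvAv : star v ⬝ᵥ A *ᵥ v = hA.eigenvalues i := by
    rw [hA.mulVec_eigenvectorBasis i, dotProduct_smul, hvv, Algebra.smul_def, mul_one]
  have hlt := hsub.dotProduct_mulVec_pos hv
  have hgt := hadd.dotProduct_mulVec_pos hv
  rw [sub_mulVec, one_mulVec, dotProduct_sub, hvv, hvAv, sub_pos] at hlt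
  rw [add_mulVec, one_mulVec, dotProduct_add, hvv, hvAv] at hgt
  norm_cast at hlt hgt
  exact abs_lt.2 ⟨by linarith, hlt⟩

lemma tendsto_pow_zero_of_posDef [DecidableEq m] [RCLike 𝕜] {A : Matrix m m 𝕜}
    (hsub : (1 - A).PosDef) (hadd : (1 + A).PosDef) :
    Tendsto (fun T : ℕ => A ^ T) atTop (𝓝 0) := by
  have hA : A.IsHermitian := by
    simpa using (isHermitian_one (n := m) (α := 𝕜)).sub hsub.isHermitian
  have hpow (T : ℕ) : A ^ T = Unitary.conjStarAlgAut 𝕜 _ hA.eigenvectorUnitary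
      (diagonal fun i => (hA.eigenvalues i : 𝕜) ^ T) := by
    conv_lhs => rw [hA.spectral_theorem, ← map_pow, diagonal_pow]
    rfl
  have hdiagonal : Tendsto (fun T : ℕ => diagonal fun i => (hA.eigenvalues i : 𝕜) ^ T) atTop
      (𝓝 (diagonal fun _ => 0)) :=
    (continuous_id.matrix_diagonal.tendsto _).comp <| tendsto_pi_nhds.2 fun i =>
      tendsto_pow_atTop_nhds_zero_of_norm_lt_one <| by
        simpa using abs_eigenvalues_lt_one_of_posDef hA hsub hadd i
  simp only [hpow, Unitary.conjStarAlgAut_apply]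
  simpa using (hdiagonal.const_mul _).mul_const _

lemma rank_eq_card_iff_isUnit_det [DecidableEq m] [Field 𝕜] {A : Matrix m m 𝕜} :
    A.rank = Fintype.card m ↔ IsUnit A.det := by
  rw [← isUnit_iff_isUnit_det]
  refine ⟨fun h => mulVec_surjective_iff_isUnit.1 ?_, A.rank_of_isUnit⟩
  exact LinearMap.range_eq_top.1 (Submodule.eq_top_of_finrank_eq
    (h.trans (Module.finrank_fintype_fun_eq_card 𝕜).symm))

lemma inv_smul_of_ne_zero [DecidableEq m] [Field 𝕜] {r : 𝕜} (hr : r ≠ 0) {A : Matrix m m 𝕜}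
    (hA : IsUnit A.det) : (r • A)⁻¹ = r⁻¹ • A⁻¹ := by
  have := invertibleOfNonzero hr
  rw [inv_smul A r hA, invOf_eq_inv]

lemma tendsto_matrix_inv [DecidableEq m] [Field 𝕜] [TopologicalSpace 𝕜]
    [IsTopologicalDivisionRing 𝕜]
    {α : Type*} {l : Filter α} {A : α → Matrix m m 𝕜} {M : Matrix m m 𝕜}
    (hA : Tendsto A l (𝓝 M)) (hM : IsUnit M.det) : Tendsto (fun x => (A x)⁻¹) l (𝓝 M⁻¹) := by
  have tendsto_det : Tendsto (fun x => (A x).det) l (𝓝 M.det) :=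
    (continuous_id.matrix_det.tendsto M).comp hA
  have tendsto_adjugate : Tendsto (fun x => (A x).adjugate) l (𝓝 M.adjugate) :=
    (continuous_id.matrix_adjugate.tendsto M).comp hA
  simp only [Matrix.inv_def, Ring.inverse_eq_inv']
  exact (tendsto_det.inv₀ hM.ne_zero).smul tendsto_adjugate

variable {α : Type*} [MeasurableSpace α] [MeasurableSpace 𝕜]

lemma measurable_mulVec {l : Type*} [NonUnitalNonAssocSemiring 𝕜] [MeasurableAdd₂ 𝕜]
    [MeasurableMul₂ 𝕜] {A : α → Matrix l m 𝕜} {v : α → m → 𝕜}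
    (hA : ∀ i j, Measurable fun x => A x i j) (hv : ∀ j, Measurable fun x => v x j) (i : l) :
    Measurable fun x => (A x *ᵥ v x) i :=
  Finset.measurable_sum _ fun j _ => (hA i j).mul (hv j)

variable [DecidableEq m] [Field 𝕜] [MeasurableAdd₂ 𝕜] [MeasurableMul₂ 𝕜]
  {A : α → Matrix m m 𝕜}

lemma measurable_matrix_det (hA : ∀ i j, Measurable fun x => A x i j) :
    Measurable fun x => (A x).det := by
  simp only [det_apply']
  exact Finset.measurable_sum _ fun p _ =>
    (Finset.measurable_prod _ fun i _ => hA (p i) i).const_mul _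

lemma measurable_matrix_inv [MeasurableInv 𝕜] (hA : ∀ i j, Measurable fun x => A x i j)
    (i j : m) : Measurable fun x => (A x)⁻¹ i j := by
  simp only [Matrix.inv_def, Matrix.smul_apply, Ring.inverse_eq_inv', smul_eq_mul, adjugate_apply]
  refine (measurable_matrix_det hA).inv.mul (measurable_matrix_det fun a b => ?_)
  by_cases h : a = j
  · simp [updateRow_apply, h]
  · simpa [updateRow_apply, h] using hA a b

end Matrices

variable {Ω : Type*} {d K : ℕ}

/-- The values of a unit, `(X, W, Y(0), Y(1), H)`. -/
abbrev Obs (d K : ℕ) := (Fin d → ℝ) × Bool × ℝ × ℝ × Fin K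

/-- The coefficients `θ(w) = (c(w), β(w))` of arm `w`. -/
def theta (c : Bool → ℝ) (β : Bool → Fin d → ℝ) (w : Bool) : Fin (d + 1) → ℝ :=
  Fin.cons (c w) (β w)

/-- The sign with which arm `w` enters a treatment effect: `1` for the treated arm and `-1` for
the control arm. -/
def armSign (w : Bool) : ℝ := if w then 1 else -1

lemma armSign_mul_self (w : Bool) : armSign w * armSign w = 1 := by cases w <;> simp [armSign]

lemma aug_dotProduct (x : Fin d → ℝ) (v : Fin (d + 1) → ℝ) :
    aug x ⬝ᵥ v = v 0 + x ⬝ᵥ (fun j => v j.succ) := by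
  simp [aug, dotProduct, Fin.sum_univ_succ]

lemma measurable_aug (a : Fin (d + 1)) : Measurable fun x : Fin d → ℝ => aug x a := by
  cases a using Fin.cases with
  | zero => simp [aug]
  | succ j => simpa [aug] using measurable_pi_apply j

namespace Obs

/-- The cell of a unit: its study and its arm. -/
def cell (z : Obs d K) : Fin K × Bool := (z.2.2.2.2, z.2.1)

/-- The indicator that a unit belongs to one of the cells in `A`. -/
def ind (A : Finset (Fin K × Bool)) (z : Obs d K) : ℝ := if cell z ∈ A then 1 else 0

/-- The observed outcome of a unit. -/
def outcome (z : Obs d K) : ℝ := if z.2.1 then z.2.2.2.1 else z.2.2.1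

/-- The covariates of a unit, with intercept. -/
def design (z : Obs d K) : Fin (d + 1) → ℝ := aug z.1

/-- The features of a unit: all its values except the potential outcomes. -/
def features (z : Obs d K) : Fin K × Bool × (Fin d → ℝ) := (z.2.2.2.2, z.2.1, z.1)

/-- The noise `ε(W)` of the observed outcome. -/
def resid (c : Bool → ℝ) (β : Bool → Fin d → ℝ) (z : Obs d K) : ℝ :=
  outcome z - design z ⬝ᵥ theta c β z.2.1

/-- The expected treatment effect `X' (θ(1) - θ(0))` of a unit given its covariates. -/
def effect (c : Bool → ℝ) (β : Bool → Fin d → ℝ) (z : Obs d K) : ℝ :=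
  design z ⬝ᵥ (theta c β true - theta c β false)

lemma measurable_cell : Measurable (cell : Obs d K → _) := by unfold cell; fun_prop

lemma measurable_features : Measurable (features : Obs d K → _) := by unfold features; fun_prop

lemma measurable_comp_cell (f : Fin K × Bool → ℝ) : Measurable fun z : Obs d K => f (cell z) :=
  (measurable_of_finite f).comp measurable_cell

lemma measurable_ind (A : Finset (Fin K × Bool)) : Measurable (ind A : Obs d K → ℝ) :=
  measurable_comp_cell fun q => if q ∈ A then 1 else 0

lemma measurable_outcome : Measurable (outcome : Obs d K → ℝ) := by
  unfold outcome
  exact Measurable.ite ((measurable_fst.comp measurable_snd) (measurableSet_singleton true))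
    (by fun_prop) (by fun_prop)

lemma measurable_design (a : Fin (d + 1)) : Measurable fun z : Obs d K => design z a :=
  (measurable_aug a).comp measurable_fst

lemma measurable_design_dotProduct {v : Obs d K → Fin (d + 1) → ℝ}
    (hv : ∀ a, Measurable fun z => v z a) : Measurable fun z : Obs d K => design z ⬝ᵥ v z :=
  Finset.measurable_sum _ fun a _ => (measurable_design a).mul (hv a)

lemma measurable_resid (c : Bool → ℝ) (β : Bool → Fin d → ℝ) :
    Measurable (resid c β : Obs d K → ℝ) :=
  measurable_outcome.sub
    (measurable_design_dotProduct fun a => measurable_comp_cell fun q => theta c β q.2 a)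

lemma measurable_effect (c : Bool → ℝ) (β : Bool → Fin d → ℝ) :
    Measurable (effect c β : Obs d K → ℝ) :=
  measurable_design_dotProduct fun _ => measurable_const

end Obs

open Obs

namespace Units

variable (D : Units Ω d K)

section SampleSums

/-- The values of unit `i`. -/
def obs (i : ℕ) (ω : Ω) : Obs d K :=
  (D.X i ω, D.W i ω, D.Y false i ω, D.Y true i ω, D.H i ω)

/-- Indices of the units in one of the cells in `A`. All subsamples of the model (everybody, a
study, an arm, a cell) are of this form. -/
def idx (n : ℕ) (A : Finset (Fin K × Bool)) (ω : Ω) : Finset ℕ :=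
  {i ∈ range n | cell (D.obs i ω) ∈ A}

/-- The sum of the covariates (with intercept) over the cells in `A`. -/
def designSum (n : ℕ) (A : Finset (Fin K × Bool)) (ω : Ω) : Fin (d + 1) → ℝ :=
  ∑ i ∈ D.idx n A ω, aug (D.X i ω)

/-- The score `∑ ε X'` of the least squares regression over the cells in `A`. -/
def score (c : Bool → ℝ) (β : Bool → Fin d → ℝ) (n : ℕ) (A : Finset (Fin K × Bool)) (ω : Ω) :
    Fin (d + 1) → ℝ :=
  ∑ i ∈ D.idx n A ω, resid c β (D.obs i ω) • aug (D.X i ω)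

/-- The vector which a regression over the cells in `A`, evaluated at the covariates of the cells
in `B`, pairs with its score. -/
def olsWeight (n : ℕ) (B A : Finset (Fin K × Bool)) (ω : Ω) : Fin (d + 1) → ℝ :=
  D.designSum n B ω ᵥ* (D.gram (D.idx n A ω) ω)⁻¹

lemma idx_univ (n : ℕ) (ω : Ω) : D.idx n univ ω = range n := by simp [idx]

lemma idx_arm (n : ℕ) (w : Bool) (ω : Ω) : D.idx n (univ ×ˢ {w}) ω = D.armIdx n w ω := by
  simp only [idx, armIdx, cell, obs, mem_product, mem_univ, mem_singleton, true_and]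

lemma idx_study (n : ℕ) (k : Fin K) (ω : Ω) : D.idx n ({k} ×ˢ univ) ω = D.studyIdx n k ω := by
  simp only [idx, studyIdx, cell, obs, mem_product, mem_univ, mem_singleton, and_true]

lemma idx_cell (n : ℕ) (k : Fin K) (w : Bool) (ω : Ω) :
    D.idx n {(k, w)} ω = D.cellIdx n k w ω := by
  simp [idx, cellIdx, cell, obs]

lemma sum_idx {M : Type*} [AddCommMonoid M] [Module ℝ M] (n : ℕ) (A : Finset (Fin K × Bool))
    (ω : Ω) (f : ℕ → M) :
    ∑ i ∈ D.idx n A ω, f i = ∑ i ∈ range n, ind A (D.obs i ω) • f i := by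
  simp only [idx, Finset.sum_filter, ind, ite_smul, one_smul, zero_smul]

lemma sum_studyIdx {M : Type*} [AddCommMonoid M] (n : ℕ) (ω : Ω) (f : ℕ → M) :
    ∑ k, ∑ i ∈ D.studyIdx n k ω, f i = ∑ i ∈ range n, f i :=
  Finset.sum_fiberwise (range n) (fun i => D.H i ω) f

lemma sum_cellIdx {M : Type*} [AddCommMonoid M] (n : ℕ) (w : Bool) (ω : Ω) (f : ℕ → M) :
    ∑ k, ∑ i ∈ D.cellIdx n k w ω, f i = ∑ i ∈ D.armIdx n w ω, f i := by
  rw [← Finset.sum_fiberwise (D.armIdx n w ω) (fun i => D.H i ω) f]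
  simp only [cellIdx, armIdx, Finset.filter_filter, and_comm]

lemma designSum_apply (n : ℕ) (A : Finset (Fin K × Bool)) (ω : Ω) (a : Fin (d + 1)) :
    D.designSum n A ω a = ∑ i ∈ range n, ind A (D.obs i ω) * design (D.obs i ω) a := by
  simp [designSum, sum_idx, Finset.sum_apply, obs, design]

lemma score_apply (c : Bool → ℝ) (β : Bool → Fin d → ℝ) (n : ℕ) (A : Finset (Fin K × Bool))
    (ω : Ω) (a : Fin (d + 1)) :
    D.score c β n A ω a = ∑ i ∈ range n,
      ind A (D.obs i ω) * (design (D.obs i ω) a * resid c β (D.obs i ω)) := by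
  simp [score, sum_idx, Finset.sum_apply, obs, design, mul_comm]

lemma gram_idx_apply (n : ℕ) (A : Finset (Fin K × Bool)) (ω : Ω) (a b : Fin (d + 1)) :
    D.gram (D.idx n A ω) ω a b = ∑ i ∈ range n,
      ind A (D.obs i ω) * (design (D.obs i ω) a * design (D.obs i ω) b) := by
  simp [gram, sum_idx, Matrix.sum_apply, vecMulVec_apply, obs, design]

lemma Yobs_eq_outcome (i : ℕ) (ω : Ω) : D.Yobs i ω = outcome (D.obs i ω) := by
  cases h : D.W i ω <;> simp [Yobs, outcome, obs, h]

lemma outcome_obs (c : Bool → ℝ) (β : Bool → Fin d → ℝ) (i : ℕ) (ω : Ω) :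
    outcome (D.obs i ω) = aug (D.X i ω) ⬝ᵥ theta c β (D.W i ω) + resid c β (D.obs i ω) :=
  (add_sub_cancel _ _).symm

lemma sampleEffect_eq (c : Bool → ℝ) (β : Bool → Fin d → ℝ) (n : ℕ) (ω : Ω) :
    D.sampleEffect c β n ω = (∑ i ∈ range n, effect c β (D.obs i ω)) / n := by
  simp [sampleEffect, gFormula, effect, design, obs, theta, dotProduct_sub]

lemma tauGivenH_eq [MeasurableSpace Ω] (P : Measure Ω) (n : ℕ) (ω : Ω) :
    D.tauGivenH P n ω = (∑ i ∈ range n, D.tauStudy P (cell (D.obs i ω)).1) / n := by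
  have sum_study (k : Fin K) : ∑ i ∈ D.studyIdx n k ω, D.tauStudy P (cell (D.obs i ω)).1 =
      (D.studyIdx n k ω).card * D.tauStudy P k := by
    rw [← nsmul_eq_mul, ← sum_const]
    refine sum_congr rfl fun i hi => ?_
    rw [← (mem_filter.1 hi).2]
    rfl
  simp only [tauGivenH, studyFrac, ← D.sum_studyIdx n ω, sum_study, div_mul_eq_mul_div,
    Finset.sum_div]

end SampleSums

section LeastSquares

lemma gram_mulVec (s : Finset ℕ) (ω : Ω) (v : Fin (d + 1) → ℝ) :
    D.gram s ω *ᵥ v = ∑ i ∈ s, (aug (D.X i ω) ⬝ᵥ v) • aug (D.X i ω) := by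
  simp only [gram, sum_mulVec, vecMulVec_mulVec, op_smul_eq_smul]

lemma gram_posSemidef (s : Finset ℕ) (ω : Ω) : (D.gram s ω).PosSemidef :=
  posSemidef_sum _ fun i _ => by simpa using posSemidef_vecMulVec_self_star (aug (D.X i ω))

lemma gram_mulVec_ols {s : Finset ℕ} {ω : Ω} (h : IsUnit (D.gram s ω).det) :
    D.gram s ω *ᵥ D.ols s ω = ∑ i ∈ s, D.Yobs i ω • aug (D.X i ω) := by
  rw [ols, mulVec_mulVec, mul_nonsing_inv _ h, one_mulVec]

lemma ols_eq_theta_add {c : Bool → ℝ} {β : Bool → Fin d → ℝ} {n : ℕ}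
    {A : Finset (Fin K × Bool)} {w : Bool} (hA : ∀ q ∈ A, q.2 = w) {ω : Ω}
    (h : IsUnit (D.gram (D.idx n A ω) ω).det) :
    D.ols (D.idx n A ω) ω =
      theta c β w + (D.gram (D.idx n A ω) ω)⁻¹ *ᵥ D.score c β n A ω := by
  have normal_equations : ∑ i ∈ D.idx n A ω, D.Yobs i ω • aug (D.X i ω) =
      D.gram (D.idx n A ω) ω *ᵥ theta c β w + D.score c β n A ω := by
    rw [gram_mulVec, score, ← Finset.sum_add_distrib]
    refine Finset.sum_congr rfl fun i hi => ?_
    have hw : D.W i ω = w := hA _ (Finset.mem_filter.1 hi).2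
    rw [Yobs_eq_outcome, D.outcome_obs c β, hw, add_smul]
  rw [ols, normal_equations, mulVec_add, mulVec_mulVec, nonsing_inv_mul _ h, one_mulVec]

lemma sum_aug_dotProduct_ols_sub_ols (c : Bool → ℝ) (β : Bool → Fin d → ℝ) {n : ℕ}
    (B : Finset (Fin K × Bool)) {A : Bool → Finset (Fin K × Bool)}
    (hA : ∀ w, ∀ q ∈ A w, q.2 = w) {ω : Ω}
    (h : ∀ w, IsUnit (D.gram (D.idx n (A w) ω) ω).det) :
    ∑ i ∈ D.idx n B ω, aug (D.X i ω) ⬝ᵥ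
        (D.ols (D.idx n (A true) ω) ω - D.ols (D.idx n (A false) ω) ω) =
      ∑ i ∈ D.idx n B ω, effect c β (D.obs i ω) +
        ∑ w, armSign w * (D.olsWeight n B (A w) ω ⬝ᵥ D.score c β n (A w) ω) := by
  simp only [D.ols_eq_theta_add (hA _) (h _) (c := c) (β := β), add_sub_add_comm,
    dotProduct_add, Finset.sum_add_distrib]
  congr 1
  rw [← sum_dotProduct, ← designSum, Fintype.sum_bool]
  simp only [olsWeight, armSign, ← dotProduct_mulVec, dotProduct_sub]
  simp [sub_eq_add_neg]

end LeastSquares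

section Estimators

lemma gFormula_eq (s : Finset ℕ) (θ : Bool → Fin (d + 1) → ℝ) (ω : Ω) :
    D.gFormula s θ ω = (∑ i ∈ s, aug (D.X i ω) ⬝ᵥ (θ true - θ false)) / (s.card : ℝ) := by
  simp [gFormula, dotProduct_sub]

lemma studyFrac_mul_gFormula (n : ℕ) (k : Fin K) (θ : Bool → Fin (d + 1) → ℝ) (ω : Ω) :
    D.studyFrac n k ω * D.gFormula (D.studyIdx n k ω) θ ω =
      (∑ i ∈ D.studyIdx n k ω, aug (D.X i ω) ⬝ᵥ (θ true - θ false)) / n := by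
  rw [gFormula_eq, studyFrac]
  rcases (D.studyIdx n k ω).eq_empty_or_nonempty with h | h
  · simp [h]
  · have : ((D.studyIdx n k ω).card : ℝ) ≠ 0 := by exact_mod_cast h.card_ne_zero
    field_simp

lemma federated_eq_gFormula (n : ℕ) (θ : Bool → Fin (d + 1) → ℝ) (ω : Ω) :
    D.federated n θ ω = D.gFormula (range n) θ ω := by
  simp only [federated, studyFrac_mul_gFormula]
  rw [← Finset.sum_div, sum_studyIdx, gFormula_eq, card_range]

lemma tauPool_eq_sampleEffect_add (c : Bool → ℝ) (β : Bool → Fin d → ℝ) {n : ℕ} {ω : Ω}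
    (h : ∀ w, IsUnit (D.gram (D.armIdx n w ω) ω).det) :
    D.tauPool n ω = D.sampleEffect c β n ω + (∑ w, armSign w *
      (D.olsWeight n univ (univ ×ˢ {w}) ω ⬝ᵥ D.score c β n (univ ×ˢ {w}) ω)) / n := by
  have error := D.sum_aug_dotProduct_ols_sub_ols c β (n := n) univ
    (A := fun w => univ ×ˢ {w}) (fun w q hq => mem_singleton.1 (mem_product.1 hq).2)
    (ω := ω) fun w => by simpa only [idx_arm] using h w
  simp only [idx_univ, idx_arm] at error
  rw [tauPool, gFormula_eq, error, sampleEffect_eq, card_range, add_div]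

lemma tauMetaSW_eq_sampleEffect_add (c : Bool → ℝ) (β : Bool → Fin d → ℝ) {n : ℕ} {ω : Ω}
    (h : ∀ k w, IsUnit (D.gram (D.cellIdx n k w ω) ω).det) :
    D.tauMetaSW n ω = D.sampleEffect c β n ω + (∑ q : Fin K × Bool, armSign q.2 *
      (D.olsWeight n ({q.1} ×ˢ univ) {q} ω ⬝ᵥ D.score c β n {q} ω)) / n := by
  have error (k : Fin K) := D.sum_aug_dotProduct_ols_sub_ols c β (n := n) ({k} ×ˢ univ)
    (A := fun w => {(k, w)}) (fun w q hq => by rw [mem_singleton.1 hq])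
    (ω := ω) fun w => by simpa only [idx_cell] using h k w
  simp only [idx_study, idx_cell] at error
  simp only [tauMetaSW, tauLocal, studyFrac_mul_gFormula, error]
  rw [← Finset.sum_div, Finset.sum_add_distrib, sum_studyIdx, sampleEffect_eq, add_div,
    Fintype.sum_prod_type]

lemma localFullRank_iff (n : ℕ) (ω : Ω) :
    D.LocalFullRank n ω ↔ ∀ k w, IsUnit (D.gram (D.cellIdx n k w ω) ω).det := by
  simp only [LocalFullRank, ← rank_eq_card_iff_isUnit_det, Fintype.card_fin]

lemma sum_gram_cellIdx (n : ℕ) (w : Bool) (ω : Ω) :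
    ∑ k, D.gram (D.cellIdx n k w ω) ω = D.gram (D.armIdx n w ω) ω :=
  D.sum_cellIdx n w ω _

variable {D} {n : ℕ} {ω : Ω}

lemma posDef_gram {s : Finset ℕ} (h : IsUnit (D.gram s ω).det) : (D.gram s ω).PosDef :=
  (D.gram_posSemidef s ω).posDef_iff_isUnit.2 ((isUnit_iff_isUnit_det _).2 h)

lemma LocalFullRank.isUnit_det_gram_armIdx (h : D.LocalFullRank n ω) (w : Bool) :
    IsUnit (D.gram (D.armIdx n w ω) ω).det := by
  rw [← isUnit_iff_isUnit_det, ← sum_gram_cellIdx, ← add_sum_erase _ _ (mem_univ (D.H 0 ω))]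
  exact ((posDef_gram ((D.localFullRank_iff n ω).1 h _ w)).add_posSemidef
    (posSemidef_sum _ fun k _ => D.gram_posSemidef _ ω)).isUnit

lemma tauIVW_eq_tauPool {σ : ℝ} (hσ : σ ≠ 0) (h : D.LocalFullRank n ω) :
    D.tauIVW σ n ω = D.tauPool n ω := by
  have hσ2 : σ ^ 2 ≠ 0 := pow_ne_zero 2 hσ
  have cell_isUnit := (D.localFullRank_iff n ω).1 h
  have inv_localVar (k : Fin K) (w : Bool) :
      (D.localVar σ n k w ω)⁻¹ = (σ ^ 2)⁻¹ • D.gram (D.cellIdx n k w ω) ω := by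
    rw [localVar, inv_smul_of_ne_zero hσ2 (isUnit_nonsing_inv_det _ (cell_isUnit k w)),
      nonsing_inv_nonsing_inv _ (cell_isUnit k w)]
  rw [tauIVW, tauPool, federated_eq_gFormula]
  congr 1
  funext w
  calc D.thetaIVW σ n ω w
      = ((σ ^ 2)⁻¹ • D.gram (D.armIdx n w ω) ω)⁻¹ *ᵥ
          ((σ ^ 2)⁻¹ • ∑ i ∈ D.armIdx n w ω, D.Yobs i ω • aug (D.X i ω)) := by
        simp only [thetaIVW, inv_localVar, smul_mulVec, D.gram_mulVec_ols (cell_isUnit _ w),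
          ← Finset.smul_sum, sum_gram_cellIdx, sum_cellIdx]
    _ = D.ols (D.armIdx n w ω) ω := by
        rw [inv_smul_of_ne_zero (inv_ne_zero hσ2) (h.isUnit_det_gram_armIdx w), smul_mulVec,
          mulVec_smul, smul_smul, inv_mul_cancel₀ (inv_ne_zero hσ2), one_smul, ols]

end Estimators

section GradientDescent

lemma lossGrad_eq (s : Finset ℕ) (ω : Ω) (θ : Fin (d + 1) → ℝ) :
    D.lossGrad s ω θ = -(2 / (s.card : ℝ)) •
      ((∑ i ∈ s, D.Yobs i ω • aug (D.X i ω)) - D.gram s ω *ᵥ θ) := by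
  simp only [lossGrad, gram_mulVec, sub_smul, Finset.sum_sub_distrib]

lemma sum_card_cellIdx (n : ℕ) (w : Bool) (ω : Ω) :
    ∑ k, ((D.cellIdx n k w ω).card : ℝ) = (D.armIdx n w ω).card := by
  simpa using D.sum_cellIdx n w ω fun _ => (1 : ℝ)

lemma fedAvgRound_one (n : ℕ) (w : Bool) (ω : Ω) (η : ℝ) (θ : Fin (d + 1) → ℝ) :
    D.fedAvgRound n w ω η 1 θ =
      (((D.armIdx n w ω).card : ℝ) / (D.armIdx n w ω).card) • θ +
        (η * (2 / (D.armIdx n w ω).card)) •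
          ((∑ i ∈ D.armIdx n w ω, D.Yobs i ω • aug (D.X i ω)) -
            D.gram (D.armIdx n w ω) ω *ᵥ θ) := by
  have study_step (N : ℝ) (s : Finset ℕ) :
      ((s.card : ℝ) / N) • D.localUpdate s ω η 1 θ = ((s.card : ℝ) / N) • θ +
        (η * (2 / N)) • ((∑ i ∈ s, D.Yobs i ω • aug (D.X i ω)) - D.gram s ω *ᵥ θ) := by
    rcases s.eq_empty_or_nonempty with rfl | hs
    · simp [gram]
    have hcard : (s.card : ℝ) ≠ 0 := by exact_mod_cast hs.card_ne_zero
    rw [localUpdate, Function.iterate_one, lossGrad_eq, neg_smul, smul_neg, sub_neg_eq_add,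
      smul_add, smul_smul, smul_smul]
    congr 2
    field_simp
  simp only [fedAvgRound, study_step, Finset.sum_add_distrib, ← Finset.sum_smul,
    ← Finset.smul_sum, ← Finset.sum_div, sum_card_cellIdx, Finset.sum_sub_distrib, sum_cellIdx,
    ← sum_mulVec, sum_gram_cellIdx]

variable {D} {n : ℕ} {w : Bool} {ω : Ω}

lemma card_armIdx_pos (h : IsUnit (D.gram (D.armIdx n w ω) ω).det) :
    (0 : ℝ) < (D.armIdx n w ω).card := by
  rw [Nat.cast_pos, card_pos, Finset.nonempty_iff_ne_empty]
  intro hempty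
  simp [hempty, gram, det_zero] at h

lemma fedAvgRound_one_sub_ols (h : IsUnit (D.gram (D.armIdx n w ω) ω).det) (η : ℝ)
    (θ : Fin (d + 1) → ℝ) :
    D.fedAvgRound n w ω η 1 θ - D.ols (D.armIdx n w ω) ω =
      (1 - η • D.lossHess n w ω) *ᵥ (θ - D.ols (D.armIdx n w ω) ω) := by
  rw [fedAvgRound_one, div_self (card_armIdx_pos h).ne', ← D.gram_mulVec_ols h, one_smul,
    lossHess, sub_mulVec, one_mulVec, smul_mulVec, smul_mulVec, mulVec_sub, smul_smul,
    ← neg_sub (D.gram (D.armIdx n w ω) ω *ᵥ θ), smul_neg]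
  abel

lemma fedAvg_one_eq (h : IsUnit (D.gram (D.armIdx n w ω) ω).det) (η : ℝ)
    (θ₀ : Fin (d + 1) → ℝ) (T : ℕ) :
    D.fedAvg n w ω η 1 T θ₀ = (1 - η • D.lossHess n w ω) ^ T *ᵥ
      (θ₀ - D.ols (D.armIdx n w ω) ω) + D.ols (D.armIdx n w ω) ω := by
  induction T with
  | zero => simp [fedAvg]
  | succ T ih =>
    rw [fedAvg, Function.iterate_succ_apply', ← fedAvg, ← sub_eq_iff_eq_add,
      fedAvgRound_one_sub_ols h, ih, add_sub_cancel_right, mulVec_mulVec, pow_succ']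

lemma tendsto_fedAvg (h : IsUnit (D.gram (D.armIdx n w ω) ω).det) {η : ℝ} (hη : 0 < η)
    (hη2 : ((2 : ℝ) • (1 : Matrix (Fin (d + 1)) (Fin (d + 1)) ℝ) -
      η • D.lossHess n w ω).PosDef) (θ₀ : Fin (d + 1) → ℝ) :
    Tendsto (fun T : ℕ => D.fedAvg n w ω η 1 T θ₀) atTop (𝓝 (D.ols (D.armIdx n w ω) ω)) := by
  have contraction : Tendsto (fun T : ℕ => (1 - η • D.lossHess n w ω) ^ T) atTop (𝓝 0) := by
    refine tendsto_pow_zero_of_posDef ?_ (by rwa [← add_sub_assoc, ← two_smul ℝ])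
    rw [sub_sub_cancel, lossHess, smul_smul]
    exact (posDef_gram h).smul (mul_pos hη (div_pos two_pos (card_armIdx_pos h)))
  have hcont : Continuous fun M : Matrix (Fin (d + 1)) (Fin (d + 1)) ℝ =>
      M *ᵥ (θ₀ - D.ols (D.armIdx n w ω) ω) + D.ols (D.armIdx n w ω) ω := by fun_prop
  simpa only [fedAvg_one_eq h, Function.comp_def, zero_mulVec, zero_add] using
    (hcont.tendsto 0).comp contraction

lemma tauGD_eq_tauPool [MeasurableSpace Ω] {η : ℕ → Bool → Ω → ℝ} (hη : D.IsLearningRate η)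
    (θ₀ : Bool → Fin (d + 1) → ℝ) (h : D.LocalFullRank n ω) :
    D.tauGD η θ₀ n ω = D.tauPool n ω := by
  rw [tauGD, tauPool, federated_eq_gFormula]
  congr 1
  funext w
  obtain ⟨hη_pos, hη_lt⟩ := hη.2 n w ω
  exact (tendsto_fedAvg (h.isUnit_det_gram_armIdx w) hη_pos hη_lt (θ₀ w)).limUnder_eq

end GradientDescent

end Units

namespace Units

variable (D : Units Ω d K)

section Measurability

variable {mΩ : MeasurableSpace Ω}

lemma measurable_sum_idx {n : ℕ} (hcell : ∀ i < n, Measurable fun ω => cell (D.obs i ω))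
    (A : Finset (Fin K × Bool)) {f : ℕ → Ω → ℝ} (hf : ∀ i < n, Measurable (f i)) :
    Measurable fun ω => ∑ i ∈ D.idx n A ω, f i ω := by
  simp only [sum_idx, smul_eq_mul]
  refine Finset.measurable_sum _ fun i hi => Measurable.mul ?_ (hf i (mem_range.1 hi))
  exact (measurable_of_finite fun q => if q ∈ A then (1 : ℝ) else 0).comp
    (hcell i (mem_range.1 hi))

section Features

variable {n : ℕ} (hF : ∀ i < n, Measurable fun ω => features (D.obs i ω))

include hF

lemma measurable_cell_of_features {i : ℕ} (hi : i < n) :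
    Measurable fun ω => cell (D.obs i ω) :=
  (by fun_prop : Measurable fun y : Fin K × Bool × (Fin d → ℝ) => (y.1, y.2.1)).comp (hF i hi)

lemma measurable_aug_of_features {i : ℕ} (hi : i < n) (a : Fin (d + 1)) :
    Measurable fun ω => aug (D.X i ω) a :=
  (measurable_aug a).comp ((measurable_snd.comp measurable_snd).comp (hF i hi))

lemma measurable_designSum (A : Finset (Fin K × Bool)) (a : Fin (d + 1)) :
    Measurable fun ω => D.designSum n A ω a := by
  simp only [designSum, Finset.sum_apply]
  exact D.measurable_sum_idx (fun i => D.measurable_cell_of_features hF) A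
    fun i hi => D.measurable_aug_of_features hF hi a

lemma measurable_gram_idx (A : Finset (Fin K × Bool)) (a b : Fin (d + 1)) :
    Measurable fun ω => D.gram (D.idx n A ω) ω a b := by
  simp only [gram, Matrix.sum_apply, vecMulVec_apply]
  exact D.measurable_sum_idx (fun i => D.measurable_cell_of_features hF) A fun i hi =>
    (D.measurable_aug_of_features hF hi a).mul (D.measurable_aug_of_features hF hi b)

lemma measurable_olsWeight (B A : Finset (Fin K × Bool)) (a : Fin (d + 1)) :
    Measurable fun ω => D.olsWeight n B A ω a := by
  simp only [olsWeight, ← mulVec_transpose]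
  exact measurable_mulVec
    (fun i j => measurable_matrix_inv (D.measurable_gram_idx hF A) j i)
    (D.measurable_designSum hF B) a

lemma measurableSet_localFullRank : MeasurableSet {ω | D.LocalFullRank n ω} := by
  simp only [localFullRank_iff, isUnit_iff_ne_zero, Set.ofPred_forall, ← idx_cell]
  exact MeasurableSet.iInter fun k => MeasurableSet.iInter fun w =>
    measurable_matrix_det (D.measurable_gram_idx hF _) (measurableSet_singleton 0).compl

end Features

lemma measurable_features_designSigma {n i : ℕ} (hi : i < n) :
    Measurable[D.designSigma n] fun ω => features (D.obs i ω) :=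
  (measurable_pi_apply (⟨i, hi⟩ : Fin n)).comp
    (comap_measurable fun ω (j : Fin n) => (D.H j ω, D.W j ω, D.X j ω))

variable (hD : ∀ i, Measurable (D.obs i))

include hD

lemma measurable_features_obs (i : ℕ) : Measurable fun ω => features (D.obs i ω) :=
  measurable_features.comp (hD i)

lemma measurable_card_idx (n : ℕ) (A : Finset (Fin K × Bool)) :
    Measurable fun ω => ((D.idx n A ω).card : ℝ) := by
  simpa using D.measurable_sum_idx (n := n) (fun i _ => measurable_cell.comp (hD i)) A
    (f := fun _ _ => 1) fun _ _ => measurable_const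

lemma measurable_sum_Yobs_smul_aug (n : ℕ) (A : Finset (Fin K × Bool)) (a : Fin (d + 1)) :
    Measurable fun ω => (∑ i ∈ D.idx n A ω, D.Yobs i ω • aug (D.X i ω)) a := by
  simp only [Finset.sum_apply, Pi.smul_apply, smul_eq_mul, Yobs_eq_outcome]
  exact D.measurable_sum_idx (fun i _ => measurable_cell.comp (hD i)) A fun i _ =>
    (measurable_outcome.comp (hD i)).mul ((measurable_design a).comp (hD i))

lemma measurable_ols_idx (n : ℕ) (A : Finset (Fin K × Bool)) (a : Fin (d + 1)) :
    Measurable fun ω => D.ols (D.idx n A ω) ω a :=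
  measurable_mulVec
    (measurable_matrix_inv (D.measurable_gram_idx (fun i _ => D.measurable_features_obs hD i) A))
    (D.measurable_sum_Yobs_smul_aug hD n A) a

lemma measurable_gFormula_idx (n : ℕ) (A : Finset (Fin K × Bool))
    {θ : Bool → Ω → Fin (d + 1) → ℝ} (hθ : ∀ w a, Measurable fun ω => θ w ω a) :
    Measurable fun ω => D.gFormula (D.idx n A ω) (fun w => θ w ω) ω := by
  simp only [gFormula_eq]
  refine (D.measurable_sum_idx (fun i _ => measurable_cell.comp (hD i)) A fun i _ => ?_).div
    (D.measurable_card_idx hD n A)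
  exact Finset.measurable_sum _ fun a _ =>
    ((measurable_design a).comp (hD i)).mul ((hθ true a).sub (hθ false a))

lemma measurable_federated (n : ℕ)
    {θ : Bool → Ω → Fin (d + 1) → ℝ} (hθ : ∀ w a, Measurable fun ω => θ w ω a) :
    Measurable fun ω => D.federated n (fun w => θ w ω) ω := by
  simpa only [federated_eq_gFormula, idx_univ] using D.measurable_gFormula_idx hD n univ hθ

lemma measurable_studyFrac (n : ℕ) (k : Fin K) : Measurable (D.studyFrac n k) := by
  unfold studyFrac
  simpa only [idx_study] using (D.measurable_card_idx hD n ({k} ×ˢ univ)).div_const (n : ℝ)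

lemma measurable_tauPool (n : ℕ) : Measurable (D.tauPool n) := by
  have measurable_ols_armIdx (w : Bool) (a : Fin (d + 1)) :
      Measurable fun ω => D.ols (D.armIdx n w ω) ω a := by
    simpa only [idx_arm] using D.measurable_ols_idx hD n (univ ×ˢ {w}) a
  unfold tauPool
  simpa only [federated_eq_gFormula] using D.measurable_federated hD n measurable_ols_armIdx

lemma measurable_tauMetaSW (n : ℕ) : Measurable (D.tauMetaSW n) := by
  unfold tauMetaSW tauLocal
  refine Finset.measurable_sum _ fun k _ => (D.measurable_studyFrac hD n k).mul ?_
  simpa only [idx_study, idx_cell] using D.measurable_gFormula_idx hD n ({k} ×ˢ univ)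
    (θ := fun w ω => D.ols (D.idx n {(k, w)} ω) ω) fun w => D.measurable_ols_idx hD n _

lemma measurable_tauIVW (σ : ℝ) (n : ℕ) : Measurable (D.tauIVW σ n) := by
  refine D.measurable_federated hD n (θ := fun w ω => D.thetaIVW σ n ω w) fun w a => ?_
  have measurable_inv_localVar (k : Fin K) (a b : Fin (d + 1)) :
      Measurable fun ω => (D.localVar σ n k w ω)⁻¹ a b := by
    refine measurable_matrix_inv (fun a b => ?_) a b
    simp only [localVar, ← idx_cell, Matrix.smul_apply]
    exact (measurable_matrix_inv (D.measurable_gram_idx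
      (fun i _ => D.measurable_features_obs hD i) _) a b).const_smul (σ ^ 2)
  refine measurable_mulVec (measurable_matrix_inv fun a b => ?_) (fun a => ?_) a
  · simp only [Matrix.sum_apply]
    exact Finset.measurable_sum _ fun k _ => measurable_inv_localVar k a b
  · simp only [Finset.sum_apply]
    refine Finset.measurable_sum _ fun k _ =>
      measurable_mulVec (measurable_inv_localVar k) (fun b => ?_) a
    simpa only [idx_cell] using D.measurable_ols_idx hD n {(k, w)} b

lemma measurable_fedAvg_one (n : ℕ) (w : Bool) {η : Ω → ℝ} (hη : Measurable η)
    (θ₀ : Fin (d + 1) → ℝ) (T : ℕ) (a : Fin (d + 1)) :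
    Measurable fun ω => D.fedAvg n w ω (η ω) 1 T θ₀ a := by
  induction T generalizing a with
  | zero => exact measurable_const
  | succ T ih =>
    simp only [fedAvg, Function.iterate_succ_apply'] at ih ⊢
    simp only [fedAvgRound_one, Pi.add_apply, Pi.smul_apply, Pi.sub_apply, smul_eq_mul, ← idx_arm]
      at ih ⊢
    have measurable_card := D.measurable_card_idx hD n (univ ×ˢ {w})
    refine ((measurable_card.div measurable_card).mul (ih a)).add
      ((hη.mul (measurable_card.const_div 2)).mul
        ((D.measurable_sum_Yobs_smul_aug hD n _ a).sub (measurable_mulVec ?_ ih a)))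
    exact D.measurable_gram_idx (fun i _ => D.measurable_features_obs hD i) _

lemma measurable_tauGD {η : ℕ → Bool → Ω → ℝ} (hη : ∀ n w, Measurable (η n w))
    (θ₀ : Bool → Fin (d + 1) → ℝ) (n : ℕ) : Measurable (D.tauGD η θ₀ n) := by
  refine D.measurable_federated hD n (θ := fun w ω => D.thetaGD η θ₀ n ω w) fun w a => ?_
  have measurable_rounds (T : ℕ) := (measurable_pi_lambda _
    (D.measurable_fedAvg_one hD n w (hη n w) (θ₀ w) T)).stronglyMeasurable
  exact (measurable_pi_apply a).comp
    (StronglyMeasurable.limUnder (l := atTop) measurable_rounds).measurable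

lemma measurable_tauGivenH (P : Measure Ω) (n : ℕ) : Measurable (D.tauGivenH P n) :=
  Finset.measurable_sum _ fun k _ => (D.measurable_studyFrac hD n k).mul_const _

end Measurability

end Units

namespace Units

section Model

variable (D : Units Ω d K) [MeasurableSpace Ω] (P : Measure Ω)

/-- The probability of arm `q.2` within study `q.1`. -/
def armProb (q : Fin K × Bool) : ℝ :=
  if q.2 then D.treatProb P q.1 else 1 - D.treatProb P q.1

/-- The values of the first unit from which treatment is randomised: its covariates and potential
outcomes. -/
def potential (ω : Ω) : (Fin d → ℝ) × ℝ × ℝ := (D.X 0 ω, D.Y false 0 ω, D.Y true 0 ω)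

/-- The noise `ε(w)` as a function of the covariates and potential outcomes. -/
def potentialNoise (c : Bool → ℝ) (β : Bool → Fin d → ℝ) (w : Bool)
    (y : (Fin d → ℝ) × ℝ × ℝ) : ℝ :=
  (if w then y.2.2 else y.2.1) - aug y.1 ⬝ᵥ theta c β w

omit [MeasurableSpace Ω] in
lemma potentialNoise_potential (c : Bool → ℝ) (β : Bool → Fin d → ℝ) (w : Bool) (ω : Ω) :
    potentialNoise c β w (D.potential ω) = D.noise c β w 0 ω := by
  cases w <;> simp [noise, potentialNoise, potential, theta, aug_dotProduct, sub_add_eq_sub_sub]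

lemma measurable_potentialNoise (c : Bool → ℝ) (β : Bool → Fin d → ℝ) (w : Bool) :
    Measurable (potentialNoise c β w) := by
  refine Measurable.sub (by cases w <;> simp only [Bool.false_eq_true, if_true, if_false] <;>
    fun_prop) ?_
  exact Finset.measurable_sum _ fun a _ => ((measurable_aug a).comp measurable_fst).mul_const _

lemma integral_studyMeasure (k : Fin K) (f : Ω → ℝ) :
    ∫ ω, f ω ∂(D.studyMeasure P k) = (D.rho P k)⁻¹ * ∫ ω in D.H 0 ⁻¹' {k}, f ω ∂P := by
  rw [studyMeasure, ProbabilityTheory.cond, integral_smul_measure, smul_eq_mul,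
    ENNReal.toReal_inv, rho, measureReal_def]

variable {D P} {c : Bool → ℝ} {β : Bool → Fin d → ℝ} {σ : ℝ}

namespace IsCovariateShiftModel

section Randomization

variable (hD : D.IsCovariateShiftModel P c β σ)
include hD

lemma measurable_obs (i : ℕ) : Measurable (D.obs i) :=
  (hD.measurable_X i).prodMk ((hD.measurable_W i).prodMk ((hD.measurable_Y false i).prodMk
    ((hD.measurable_Y true i).prodMk (hD.measurable_H i))))

lemma measurable_potential : Measurable D.potential :=
  (hD.measurable_X 0).prodMk ((hD.measurable_Y false 0).prodMk (hD.measurable_Y true 0))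

lemma measurable_cell_obs : Measurable fun ω => cell (D.obs 0 ω) :=
  measurable_cell.comp (hD.measurable_obs 0)

lemma measurable_features_obs_zero : Measurable fun ω => features (D.obs 0 ω) :=
  measurable_features.comp (hD.measurable_obs 0)

lemma measurableSet_study (k : Fin K) : MeasurableSet (D.H 0 ⁻¹' {k}) :=
  hD.measurable_H 0 (measurableSet_singleton k)

lemma measurableSet_arm (w : Bool) : MeasurableSet (D.W 0 ⁻¹' {w}) :=
  hD.measurable_W 0 (measurableSet_singleton w)

lemma setIntegral_study (k : Fin K) (f : Ω → ℝ) :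
    ∫ ω in D.H 0 ⁻¹' {k}, f ω ∂P = D.rho P k * ∫ ω, f ω ∂(D.studyMeasure P k) := by
  rw [integral_studyMeasure, mul_inv_cancel_left₀ (hD.rho_pos k).ne']

lemma armProb_pos (q : Fin K × Bool) : 0 < D.armProb P q := by
  unfold armProb
  split_ifs
  exacts [hD.treatProb_pos q.1, sub_pos.2 (hD.treatProb_lt_one q.1)]

variable [IsProbabilityMeasure P]

lemma isProbabilityMeasure_studyMeasure (k : Fin K) :
    IsProbabilityMeasure (D.studyMeasure P k) :=
  cond_isProbabilityMeasure fun h => (hD.rho_pos k).ne' (by simp [rho, measureReal_def, h])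

lemma studyMeasure_real_arm (q : Fin K × Bool) :
    (D.studyMeasure P q.1).real (D.W 0 ⁻¹' {q.2}) = D.armProb P q := by
  have := hD.isProbabilityMeasure_studyMeasure q.1
  obtain ⟨k, _ | _⟩ := q
  · have false_eq_compl : D.W 0 ⁻¹' {false} = (D.W 0 ⁻¹' {true})ᶜ := by ext ω; simp
    simp [false_eq_compl, probReal_compl_eq_one_sub (hD.measurableSet_arm true), armProb,
      treatProb]
  · simp [armProb, treatProb]

lemma setIntegral_cell (q : Fin K × Bool) {f : (Fin d → ℝ) × ℝ × ℝ → ℝ} (hf : Measurable f) :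
    ∫ ω in (fun ω => cell (D.obs 0 ω)) ⁻¹' {q}, f (D.potential ω) ∂P =
      D.armProb P q * ∫ ω in D.H 0 ⁻¹' {q.1}, f (D.potential ω) ∂P := by
  have := hD.isProbabilityMeasure_studyMeasure q.1
  have cell_eq : (fun ω => cell (D.obs 0 ω)) ⁻¹' {q} = D.H 0 ⁻¹' {q.1} ∩ D.W 0 ⁻¹' {q.2} := by
    ext ω
    simp [cell, obs, Prod.ext_iff]
  have randomized : ∫ ω in D.W 0 ⁻¹' {q.2}, f (D.potential ω) ∂(D.studyMeasure P q.1) =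
      (D.studyMeasure P q.1).real (D.W 0 ⁻¹' {q.2}) *
        ∫ ω, f (D.potential ω) ∂(D.studyMeasure P q.1) :=
    Indep.setIntegral_eq_mul (hD.measurable_W 0).comap_le (hD.randomized q.1)
      hD.measurable_potential.aemeasurable ⟨{q.2}, measurableSet_singleton _, rfl⟩
      hf.aestronglyMeasurable
  rw [cell_eq, ← setIntegral_indicator (hD.measurableSet_arm q.2), hD.setIntegral_study,
    integral_indicator (hD.measurableSet_arm q.2), randomized, hD.studyMeasure_real_arm,
    hD.setIntegral_study, mul_left_comm]

variable {r : Fin K × Bool → (Fin d → ℝ) × ℝ × ℝ → ℝ}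
  (hr : ∀ q, Measurable (r q)) (hri : ∀ q, Integrable (fun ω => r q (D.potential ω)) P)

omit hD [MeasurableSpace Ω] [IsProbabilityMeasure P] in
lemma apply_cell_eq_sum_indicator (r : Fin K × Bool → (Fin d → ℝ) × ℝ × ℝ → ℝ) (ω : Ω) :
    r (cell (D.obs 0 ω)) (D.potential ω) = ∑ q, ((fun ω => cell (D.obs 0 ω)) ⁻¹' {q}).indicator
      (fun ω => r q (D.potential ω)) ω := by
  simp [Set.indicator]

include hri in
omit [IsProbabilityMeasure P] in
lemma integrable_apply_cell :
    Integrable (fun ω => r (cell (D.obs 0 ω)) (D.potential ω)) P := by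
  simp only [apply_cell_eq_sum_indicator r]
  exact integrable_finsetSum _ fun q _ =>
    (hri q).indicator (hD.measurable_cell_obs (measurableSet_singleton q))

include hr hri

lemma integral_apply_cell :
    ∫ ω, r (cell (D.obs 0 ω)) (D.potential ω) ∂P =
      ∑ q, D.armProb P q * ∫ ω in D.H 0 ⁻¹' {q.1}, r q (D.potential ω) ∂P := by
  have hcell (q : Fin K × Bool) := hD.measurable_cell_obs (measurableSet_singleton q)
  simp only [apply_cell_eq_sum_indicator r]
  rw [integral_finsetSum _ fun q _ => (hri q).indicator (hcell q)]
  refine Finset.sum_congr rfl fun q _ => ?_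
  rw [integral_indicator (hcell q), hD.setIntegral_cell q (hr q)]

lemma setIntegral_features_apply_cell {B : Set (Fin K × Bool × (Fin d → ℝ))}
    (hB : MeasurableSet B) :
    ∫ ω in (fun ω => features (D.obs 0 ω)) ⁻¹' B, r (cell (D.obs 0 ω)) (D.potential ω) ∂P =
      ∑ q : Fin K × Bool, D.armProb P q *
        ∫ ω in D.X 0 ⁻¹' ((fun x => (q.1, q.2, x)) ⁻¹' B) ∩ D.H 0 ⁻¹' {q.1},
          r q (D.potential ω) ∂P := by
  have slice_measurable (q : Fin K × Bool) :
      MeasurableSet ((fun x : Fin d → ℝ => (q.1, q.2, x)) ⁻¹' B) :=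
    (by fun_prop : Measurable fun x : Fin d → ℝ => (q.1, q.2, x)) hB
  have slice_measurable_X (q : Fin K × Bool) := hD.measurable_X 0 (slice_measurable q)
  have sum_over_cells := hD.integral_apply_cell
    (r := fun q => (Prod.fst ⁻¹' ((fun x => (q.1, q.2, x)) ⁻¹' B)).indicator (r q))
    (fun q => (hr q).indicator (measurable_fst (slice_measurable q)))
    (fun q => (hri q).indicator (slice_measurable_X q))
  rw [← integral_indicator (hD.measurable_features_obs_zero hB)]
  refine sum_over_cells.trans (Finset.sum_congr rfl fun q _ => ?_)
  rw [Set.inter_comm, ← setIntegral_indicator (slice_measurable_X q)]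
  rfl

end Randomization

section Residuals

variable (hD : D.IsCovariateShiftModel P c β σ)
include hD

lemma integrable_potentialNoise_sq (w : Bool) :
    Integrable (fun ω => potentialNoise c β w (D.potential ω) ^ 2) P := by
  simpa only [potentialNoise_potential] using (hD.memLp_noise w).integrable_sq

lemma measurable_resid_obs (i : ℕ) : Measurable fun ω => resid c β (D.obs i ω) :=
  (measurable_resid c β).comp (hD.measurable_obs i)

lemma comap_covariates_le : MeasurableSpace.comap (fun ω => (D.X 0 ω, D.H 0 ω)) inferInstance ≤
    (inferInstance : MeasurableSpace Ω) :=
  ((hD.measurable_X 0).prodMk (hD.measurable_H 0)).comap_le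

lemma integrable_resid_sq : Integrable (fun ω => resid c β (D.obs 0 ω) ^ 2) P :=
  hD.integrable_apply_cell (r := fun q y => potentialNoise c β q.2 y ^ 2)
    fun q => hD.integrable_potentialNoise_sq q.2

lemma memLp_resid : MemLp (fun ω => resid c β (D.obs 0 ω)) 2 P :=
  (memLp_two_iff_integrable_sq (hD.measurable_resid_obs 0).aestronglyMeasurable).2
    hD.integrable_resid_sq

variable [IsProbabilityMeasure P]

lemma integrable_potentialNoise (w : Bool) :
    Integrable (fun ω => potentialNoise c β w (D.potential ω)) P := by
  simpa only [potentialNoise_potential] using (hD.memLp_noise w).integrable one_le_two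

lemma setIntegral_potentialNoise (w : Bool) (k : Fin K) {B : Set (Fin d → ℝ)}
    (hB : MeasurableSet B) :
    ∫ ω in D.X 0 ⁻¹' B ∩ D.H 0 ⁻¹' {k}, potentialNoise c β w (D.potential ω) ∂P = 0 := by
  simp only [potentialNoise_potential]
  rw [← setIntegral_condExp (s := D.X 0 ⁻¹' B ∩ D.H 0 ⁻¹' {k}) hD.comap_covariates_le
    ((hD.memLp_noise w).integrable one_le_two)
    ⟨B ×ˢ {k}, hB.prod (measurableSet_singleton k), rfl⟩,
    integral_congr_ae (ae_restrict_of_ae (hD.noise_mean w)), integral_zero]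

lemma setIntegral_potentialNoise_sq (w : Bool) (k : Fin K) {B : Set (Fin d → ℝ)}
    (hB : MeasurableSet B) :
    ∫ ω in D.X 0 ⁻¹' B ∩ D.H 0 ⁻¹' {k}, potentialNoise c β w (D.potential ω) ^ 2 ∂P =
      ∫ _ω in D.X 0 ⁻¹' B ∩ D.H 0 ⁻¹' {k}, σ ^ 2 ∂P := by
  simp only [potentialNoise_potential]
  rw [← setIntegral_condExp (s := D.X 0 ⁻¹' B ∩ D.H 0 ⁻¹' {k}) hD.comap_covariates_le
    (hD.memLp_noise w).integrable_sq
    ⟨B ×ˢ {k}, hB.prod (measurableSet_singleton k), rfl⟩,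
    integral_congr_ae (ae_restrict_of_ae (hD.noise_var w))]

lemma setIntegral_features_resid {B : Set (Fin K × Bool × (Fin d → ℝ))} (hB : MeasurableSet B) :
    ∫ ω in (fun ω => features (D.obs 0 ω)) ⁻¹' B, resid c β (D.obs 0 ω) ∂P = 0 := by
  refine (hD.setIntegral_features_apply_cell (r := fun q => potentialNoise c β q.2)
    (fun q => measurable_potentialNoise c β q.2) (fun q => hD.integrable_potentialNoise q.2)
    hB).trans (Finset.sum_eq_zero fun q _ => ?_)
  rw [hD.setIntegral_potentialNoise _ _
    ((by fun_prop : Measurable fun x : Fin d → ℝ => (q.1, q.2, x)) hB), mul_zero]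

lemma setIntegral_features_resid_sq {B : Set (Fin K × Bool × (Fin d → ℝ))}
    (hB : MeasurableSet B) :
    ∫ ω in (fun ω => features (D.obs 0 ω)) ⁻¹' B, resid c β (D.obs 0 ω) ^ 2 ∂P =
      σ ^ 2 * P.real ((fun ω => features (D.obs 0 ω)) ⁻¹' B) := by
  have constant := hD.setIntegral_features_apply_cell (r := fun _ _ => σ ^ 2)
    (fun _ => measurable_const) (fun _ => integrable_const _) hB
  rw [setIntegral_const, smul_eq_mul, mul_comm] at constant
  rw [constant]
  refine (hD.setIntegral_features_apply_cell (r := fun q y => potentialNoise c β q.2 y ^ 2)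
    (fun q => (measurable_potentialNoise c β q.2).pow_const 2)
    (fun q => hD.integrable_potentialNoise_sq q.2) hB).trans (Finset.sum_congr rfl fun q _ => ?_)
  rw [hD.setIntegral_potentialNoise_sq _ _
    ((by fun_prop : Measurable fun x : Fin d → ℝ => (q.1, q.2, x)) hB)]

variable {u : Fin K × Bool × (Fin d → ℝ) → ℝ} (hu : Measurable u)
include hu

lemma integral_features_mul_resid
    (hint : Integrable (fun ω => u (features (D.obs 0 ω)) * resid c β (D.obs 0 ω)) P) :
    ∫ ω, u (features (D.obs 0 ω)) * resid c β (D.obs 0 ω) ∂P = 0 :=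
  integral_mul_eq_zero_of_setIntegral_eq_zero hD.measurable_features_obs_zero.comap_le
    (hu.comp (comap_measurable _)) (hD.memLp_resid.integrable one_le_two)
    (fun _ ⟨_, hB, preimage_eq⟩ => preimage_eq ▸ hD.setIntegral_features_resid hB) hint

lemma integrable_features_mul_resid_sq
    (hint : Integrable (fun ω => u (features (D.obs 0 ω))) P) :
    Integrable (fun ω => u (features (D.obs 0 ω)) * resid c β (D.obs 0 ω) ^ 2) P :=
  integrable_comp_mul_of_setIntegral_preimage_eq hD.measurable_features_obs_zero
    ((hD.measurable_resid_obs 0).pow_const 2) hD.integrable_resid_sq (fun _ => sq_nonneg _)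
    (sq_nonneg σ) (fun _ => hD.setIntegral_features_resid_sq) hu hint

lemma integral_features_mul_resid_sq :
    ∫ ω, u (features (D.obs 0 ω)) * resid c β (D.obs 0 ω) ^ 2 ∂P =
      σ ^ 2 * ∫ ω, u (features (D.obs 0 ω)) ∂P :=
  integral_comp_mul_of_setIntegral_preimage_eq hD.measurable_features_obs_zero
    ((hD.measurable_resid_obs 0).pow_const 2) hD.integrable_resid_sq (fun _ => sq_nonneg _)
    (sq_nonneg σ) (fun _ => hD.setIntegral_features_resid_sq) hu

end Residuals

end IsCovariateShiftModel

end Model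

end Units

namespace Obs

/-- The factor `X' b(H, W)` of the residual of a unit in an estimator, for a family `b` of vectors
indexed by the cells. -/
def weight (b : Fin K × Bool → Fin (d + 1) → ℝ) (z : Obs d K) : ℝ := design z ⬝ᵥ b (cell z)

/-- Influence function of a regression estimator of the treatment effect: `t` is the centring of
the effect and `b` determines the weight of the residual. -/
def influence (c : Bool → ℝ) (β : Bool → Fin d → ℝ) (t : Fin K → ℝ)
    (b : Fin K × Bool → Fin (d + 1) → ℝ) (z : Obs d K) : ℝ :=
  (effect c β z - t (cell z).1) + weight b z * resid c β z

lemma measurable_weight (b : Fin K × Bool → Fin (d + 1) → ℝ) :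
    Measurable (weight b : Obs d K → ℝ) :=
  measurable_design_dotProduct fun a => measurable_comp_cell fun q => b q a

lemma measurable_influence (c : Bool → ℝ) (β : Bool → Fin d → ℝ) (t : Fin K → ℝ)
    (b : Fin K × Bool → Fin (d + 1) → ℝ) : Measurable (influence c β t b) :=
  ((measurable_effect c β).sub (measurable_comp_cell fun q => t q.1)).add
    ((measurable_weight b).mul (measurable_resid c β))

lemma measurable_aug_dotProduct_cell (b : Fin K × Bool → Fin (d + 1) → ℝ) :
    Measurable fun y : Fin K × Bool × (Fin d → ℝ) => aug y.2.2 ⬝ᵥ b (y.1, y.2.1) :=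
  Finset.measurable_sum _ fun a _ => ((measurable_aug a).comp (by fun_prop)).mul
    ((measurable_of_finite fun q : Fin K × Bool => b q a).comp (by fun_prop))

lemma weight_sum_ite {J : Type*} (s : Finset J) (A : J → Finset (Fin K × Bool))
    (v : J → Fin (d + 1) → ℝ) (z : Obs d K) :
    weight (fun q => ∑ j ∈ s, if q ∈ A j then v j else 0) z =
      ∑ j ∈ s, ind (A j) z * (design z ⬝ᵥ v j) := by
  simp only [weight, dotProduct_sum, ind]
  refine Finset.sum_congr rfl fun j _ => ?_
  split_ifs <;> simp

lemma ind_mul_design (A : Finset (Fin K × Bool)) (a : Fin (d + 1)) (z : Obs d K) :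
    ind A z * design z a = weight (fun q => if q ∈ A then Pi.single a 1 else 0) z := by
  simp only [ind, weight]
  split_ifs <;> simp

end Obs

namespace Units

variable {D : Units Ω d K} [MeasurableSpace Ω] {P : Measure Ω} {c : Bool → ℝ}
  {β : Bool → Fin d → ℝ} {σ : ℝ}

namespace IsCovariateShiftModel

section Influence

variable (hD : D.IsCovariateShiftModel P c β σ)
include hD

lemma memLp_X_apply (j : Fin d) : MemLp (fun ω => D.X 0 ω j) 2 P :=
  hD.memLp_X.of_le ((measurable_pi_apply j).comp (hD.measurable_X 0)).aestronglyMeasurable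
    (Eventually.of_forall fun ω => norm_le_pi_norm (D.X 0 ω) j)

lemma memLp_mul_cell {f : Ω → ℝ} (hf : MemLp f 2 P) (g : Fin K × Bool → ℝ) :
    MemLp (fun ω => f ω * g (cell (D.obs 0 ω))) 2 P := by
  refine hf.of_le_mul (c := ∑ q, |g q|) (hf.aestronglyMeasurable.mul
    ((measurable_comp_cell g).comp (hD.measurable_obs 0)).aestronglyMeasurable)
    (Eventually.of_forall fun ω => ?_)
  rw [norm_mul, mul_comm]
  exact mul_le_mul_of_nonneg_right
    (Finset.single_le_sum (f := fun q => |g q|) (fun q _ => abs_nonneg _) (mem_univ _))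
    (norm_nonneg _)

variable [IsProbabilityMeasure P]

lemma memLp_cell (g : Fin K × Bool → ℝ) : MemLp (fun ω => g (cell (D.obs 0 ω))) 2 P := by
  simpa using hD.memLp_mul_cell (memLp_const (1 : ℝ)) g

lemma memLp_design (a : Fin (d + 1)) : MemLp (fun ω => design (D.obs 0 ω) a) 2 P := by
  cases a using Fin.cases with
  | zero => simpa [design, aug] using memLp_const (1 : ℝ)
  | succ j => simpa [design, aug, obs] using hD.memLp_X_apply j

lemma memLp_weight (b : Fin K × Bool → Fin (d + 1) → ℝ) :
    MemLp (fun ω => weight b (D.obs 0 ω)) 2 P := by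
  simp only [weight, dotProduct]
  exact memLp_finsetSum _ fun a _ => hD.memLp_mul_cell (hD.memLp_design a) fun q => b q a

lemma memLp_effect : MemLp (fun ω => effect c β (D.obs 0 ω)) 2 P :=
  hD.memLp_weight fun _ => theta c β true - theta c β false

lemma memLp_effect_sub (t : Fin K → ℝ) :
    MemLp (fun ω => effect c β (D.obs 0 ω) - t (cell (D.obs 0 ω)).1) 2 P :=
  hD.memLp_effect.sub (hD.memLp_cell fun q => t q.1)

lemma memLp_weight_mul_resid (b : Fin K × Bool → Fin (d + 1) → ℝ) :
    MemLp (fun ω => weight b (D.obs 0 ω) * resid c β (D.obs 0 ω)) 2 P := by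
  refine (memLp_two_iff_integrable_sq (((measurable_weight b).comp (hD.measurable_obs 0)).mul
    (hD.measurable_resid_obs 0)).aestronglyMeasurable).2 ?_
  simp only [Function.comp_apply, Pi.mul_apply, mul_pow]
  exact hD.integrable_features_mul_resid_sq ((measurable_aug_dotProduct_cell b).pow_const 2)
    (hD.memLp_weight b).integrable_sq

lemma integral_weight_mul_resid (b : Fin K × Bool → Fin (d + 1) → ℝ) :
    ∫ ω, weight b (D.obs 0 ω) * resid c β (D.obs 0 ω) ∂P = 0 :=
  hD.integral_features_mul_resid (measurable_aug_dotProduct_cell b)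
    ((hD.memLp_weight_mul_resid b).integrable one_le_two)

lemma integral_weight_mul_resid_sq (b : Fin K × Bool → Fin (d + 1) → ℝ) :
    ∫ ω, (weight b (D.obs 0 ω) * resid c β (D.obs 0 ω)) ^ 2 ∂P =
      σ ^ 2 * ∫ ω, weight b (D.obs 0 ω) ^ 2 ∂P := by
  simp only [mul_pow]
  exact hD.integral_features_mul_resid_sq ((measurable_aug_dotProduct_cell b).pow_const 2)

lemma integral_effect_sub_mul_weight_mul_resid (t : Fin K → ℝ)
    (b : Fin K × Bool → Fin (d + 1) → ℝ) :
    ∫ ω, (effect c β (D.obs 0 ω) - t (cell (D.obs 0 ω)).1) *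
      (weight b (D.obs 0 ω) * resid c β (D.obs 0 ω)) ∂P = 0 := by
  have integrable_mul := (hD.memLp_effect_sub t).integrable_mul (hD.memLp_weight_mul_resid b)
  simp only [Pi.mul_def, ← mul_assoc] at integrable_mul ⊢
  exact hD.integral_features_mul_resid
    (u := fun y => (aug y.2.2 ⬝ᵥ (theta c β true - theta c β false) - t y.1) *
      (aug y.2.2 ⬝ᵥ b (y.1, y.2.1)))
    (((measurable_aug_dotProduct_cell fun _ => theta c β true - theta c β false).sub
      ((measurable_of_finite t).comp measurable_fst)).mul (measurable_aug_dotProduct_cell b))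
    integrable_mul

lemma memLp_influence (t : Fin K → ℝ) (b : Fin K × Bool → Fin (d + 1) → ℝ) :
    MemLp (fun ω => influence c β t b (D.obs 0 ω)) 2 P :=
  (hD.memLp_effect_sub t).add (hD.memLp_weight_mul_resid b)

lemma integral_influence (t : Fin K → ℝ) (b : Fin K × Bool → Fin (d + 1) → ℝ) :
    ∫ ω, influence c β t b (D.obs 0 ω) ∂P =
      ∫ ω, (effect c β (D.obs 0 ω) - t (cell (D.obs 0 ω)).1) ∂P := by
  simp only [influence]
  rw [integral_add ((hD.memLp_effect_sub t).integrable one_le_two)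
    ((hD.memLp_weight_mul_resid b).integrable one_le_two), hD.integral_weight_mul_resid, add_zero]

lemma integral_influence_sq (t : Fin K → ℝ) (b : Fin K × Bool → Fin (d + 1) → ℝ) :
    ∫ ω, influence c β t b (D.obs 0 ω) ^ 2 ∂P =
      ∫ ω, (effect c β (D.obs 0 ω) - t (cell (D.obs 0 ω)).1) ^ 2 ∂P +
        σ ^ 2 * ∫ ω, weight b (D.obs 0 ω) ^ 2 ∂P := by
  have effect_sq := (hD.memLp_effect_sub t).integrable_sq
  have cross : Integrable (fun ω => 2 * ((effect c β (D.obs 0 ω) - t (cell (D.obs 0 ω)).1) *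
      (weight b (D.obs 0 ω) * resid c β (D.obs 0 ω)))) P :=
    ((hD.memLp_effect_sub t).integrable_mul (hD.memLp_weight_mul_resid b)).const_mul 2
  simp only [influence, add_sq, mul_assoc (2 : ℝ)]
  rw [integral_add (by exact effect_sq.add cross) (hD.memLp_weight_mul_resid b).integrable_sq,
    integral_add effect_sq cross, integral_const_mul,
    hD.integral_effect_sub_mul_weight_mul_resid, hD.integral_weight_mul_resid_sq, mul_zero,
    add_zero]

lemma memLp_ind_mul_design_mul_resid (A : Finset (Fin K × Bool)) (a : Fin (d + 1)) :
    MemLp (fun ω => ind A (D.obs 0 ω) * (design (D.obs 0 ω) a * resid c β (D.obs 0 ω))) 2 P := by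
  simpa only [← mul_assoc, ind_mul_design] using hD.memLp_weight_mul_resid _

lemma integral_ind_mul_design_mul_resid (A : Finset (Fin K × Bool)) (a : Fin (d + 1)) :
    ∫ ω, ind A (D.obs 0 ω) * (design (D.obs 0 ω) a * resid c β (D.obs 0 ω)) ∂P = 0 := by
  simpa only [← mul_assoc, ind_mul_design] using hD.integral_weight_mul_resid _

end Influence

section StudyMoments

variable (hD : D.IsCovariateShiftModel P c β σ)
include hD

lemma integral_eq_sum_study {f : Ω → ℝ} (hf : Integrable f P) :
    ∫ ω, f ω ∂P = ∑ k, ∫ ω in D.H 0 ⁻¹' {k}, f ω ∂P := by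
  simp only [← integral_indicator (hD.measurableSet_study _)]
  rw [← integral_finsetSum _ fun k _ => hf.indicator (hD.measurableSet_study k)]
  congr 1
  ext ω
  simp [Set.indicator]

lemma memLp_studyMeasure {f : Ω → ℝ} (hf : MemLp f 2 P) (k : Fin K) :
    MemLp f 2 (D.studyMeasure P k) :=
  (hf.restrict _).smul_measure (ENNReal.inv_ne_top.2 fun h =>
    (hD.rho_pos k).ne' (by simp [rho, measureReal_def, h]))

lemma setIntegral_comp_study (k : Fin K) (t : Fin K → ℝ) :
    ∫ ω in D.H 0 ⁻¹' {k}, t (cell (D.obs 0 ω)).1 ∂P = D.rho P k * t k := by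
  rw [setIntegral_congr_fun (g := fun _ => t k) (hD.measurableSet_study k)
    fun ω (hω : D.H 0 ω = k) => by simp only [cell, obs, hω]]
  simp [rho]

variable [IsProbabilityMeasure P]

lemma integral_comp_study (t : Fin K → ℝ) :
    ∫ ω, t (cell (D.obs 0 ω)).1 ∂P = ∑ k, D.rho P k * t k := by
  rw [hD.integral_eq_sum_study ((hD.memLp_cell fun q => t q.1).integrable one_le_two)]
  simp only [hD.setIntegral_comp_study]

lemma variance_aug_dotProduct (k : Fin K) (v : Fin (d + 1) → ℝ) :
    Var[fun ω => aug (D.X 0 ω) ⬝ᵥ v; D.studyMeasure P k] =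
      (fun j => v j.succ) ⬝ᵥ (D.covStudy P k *ᵥ fun j => v j.succ) := by
  have := hD.isProbabilityMeasure_studyMeasure k
  have memLp_term (j : Fin d) : MemLp (fun ω => D.X 0 ω j * v j.succ) 2 (D.studyMeasure P k) :=
    (hD.memLp_studyMeasure (hD.memLp_X_apply j) k).mul_const _
  simp only [aug_dotProduct]
  rw [variance_const_add (by
    simpa only [dotProduct] using
      (memLp_finsetSum univ fun j _ => memLp_term j).aestronglyMeasurable)]
  simp only [dotProduct]
  rw [variance_fun_sum memLp_term]
  simp only [mulVec, dotProduct, Finset.mul_sum, covariance_mul_const_left,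
    covariance_mul_const_right, covStudy, of_apply]
  exact Finset.sum_congr rfl fun i _ => Finset.sum_congr rfl fun j _ => by ring

lemma integral_aug_dotProduct_sq (k : Fin K) (v : Fin (d + 1) → ℝ) :
    ∫ ω, (aug (D.X 0 ω) ⬝ᵥ v) ^ 2 ∂(D.studyMeasure P k) =
      (fun j => v j.succ) ⬝ᵥ (D.covStudy P k *ᵥ fun j => v j.succ) +
        (∫ ω, aug (D.X 0 ω) ⬝ᵥ v ∂(D.studyMeasure P k)) ^ 2 := by
  have := hD.isProbabilityMeasure_studyMeasure k
  have memLp_aug : MemLp (fun ω => aug (D.X 0 ω) ⬝ᵥ v) 2 (D.studyMeasure P k) :=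
    hD.memLp_studyMeasure (hD.memLp_weight fun _ => v) k
  rw [← hD.variance_aug_dotProduct k v, variance_eq_sub memLp_aug]
  simp only [Pi.pow_apply, sub_add_cancel]

lemma integral_aug_dotProduct_sq_pos (k : Fin K) {v : Fin (d + 1) → ℝ} (hv : v ≠ 0) :
    0 < ∫ ω, (aug (D.X 0 ω) ⬝ᵥ v) ^ 2 ∂(D.studyMeasure P k) := by
  have := hD.isProbabilityMeasure_studyMeasure k
  by_cases hslope : (fun j : Fin d => v j.succ) = 0
  · have hv0 : v 0 ≠ 0 := fun h0 => hv (funext (Fin.cases h0 (congrFun hslope)))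
    simp only [aug_dotProduct, hslope, dotProduct_zero, add_zero, integral_const, probReal_univ,
      one_smul]
    positivity
  · rw [hD.integral_aug_dotProduct_sq]
    have := (hD.posDef k).dotProduct_mulVec_pos hslope
    rw [star_trivial] at this
    positivity

end StudyMoments

section TreatmentEffect

variable (hD : D.IsCovariateShiftModel P c β σ) [IsProbabilityMeasure P]

omit [MeasurableSpace Ω] in
lemma outcome_sub_eq (c : Bool → ℝ) (β : Bool → Fin d → ℝ) (ω : Ω) :
    D.Y true 0 ω - D.Y false 0 ω = effect c β (D.obs 0 ω) +
      (potentialNoise c β true (D.potential ω) - potentialNoise c β false (D.potential ω)) := by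
  simp only [effect, design, obs, dotProduct_sub, potentialNoise, potential, if_true,
    Bool.false_eq_true, if_false]
  ring

include hD

lemma integrable_effect : Integrable (fun ω => effect c β (D.obs 0 ω)) P :=
  hD.memLp_effect.integrable one_le_two

lemma setIntegral_effect (k : Fin K) :
    ∫ ω in D.H 0 ⁻¹' {k}, effect c β (D.obs 0 ω) ∂P = D.rho P k * D.tauStudy P k := by
  have integrable_noise (w : Bool) :=
    (hD.integrable_potentialNoise w).integrableOn (s := D.H 0 ⁻¹' {k})
  have integral_noise (w : Bool) :
      ∫ ω in D.H 0 ⁻¹' {k}, potentialNoise c β w (D.potential ω) ∂P = 0 := by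
    simpa using hD.setIntegral_potentialNoise w k MeasurableSet.univ
  rw [tauStudy, ← hD.setIntegral_study]
  simp only [outcome_sub_eq c β]
  rw [integral_add hD.integrable_effect.integrableOn
    (by exact (integrable_noise true).sub (integrable_noise false)),
    integral_sub (integrable_noise true) (integrable_noise false), integral_noise, integral_noise,
    sub_zero, add_zero]

lemma sum_rho_mul_tauStudy : ∑ k, D.rho P k * D.tauStudy P k = D.tau P := by
  have integrable_outcome_sub : Integrable (fun ω => D.Y true 0 ω - D.Y false 0 ω) P := by
    simp only [outcome_sub_eq c β]
    exact hD.integrable_effect.add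
      ((hD.integrable_potentialNoise true).sub (hD.integrable_potentialNoise false))
  rw [tau, hD.integral_eq_sum_study integrable_outcome_sub]
  simp only [tauStudy, hD.setIntegral_study]

lemma integral_effect : ∫ ω, effect c β (D.obs 0 ω) ∂P = D.tau P := by
  rw [← hD.sum_rho_mul_tauStudy, hD.integral_eq_sum_study hD.integrable_effect]
  simp only [hD.setIntegral_effect]

lemma setIntegral_effect_sub_sq (k : Fin K) (r : ℝ) :
    ∫ ω in D.H 0 ⁻¹' {k}, (effect c β (D.obs 0 ω) - r) ^ 2 ∂P = D.rho P k *
      ((β true - β false) ⬝ᵥ (D.covStudy P k *ᵥ (β true - β false)) +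
        (D.tauStudy P k - r) ^ 2) := by
  have := hD.isProbabilityMeasure_studyMeasure k
  have effect_sub_eq (ω : Ω) : effect c β (D.obs 0 ω) - r =
      aug (D.X 0 ω) ⬝ᵥ Fin.cons (c true - c false - r) (β true - β false) := by
    simp only [effect, design, obs, aug_dotProduct, theta, Fin.cons_zero,
      Fin.cons_succ, Pi.sub_def]
    ring
  have mean : ∫ ω, (effect c β (D.obs 0 ω) - r) ∂(D.studyMeasure P k) = D.tauStudy P k - r := by
    rw [integral_sub ((hD.memLp_studyMeasure hD.memLp_effect k).integrable one_le_two)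
      (integrable_const _), integral_studyMeasure, hD.setIntegral_effect,
      inv_mul_cancel_left₀ (hD.rho_pos k).ne', integral_const, probReal_univ, one_smul]
  rw [hD.setIntegral_study, ← mean]
  simp only [effect_sub_eq, hD.integral_aug_dotProduct_sq, Fin.cons_succ]

lemma integral_effect_sub_sq (t : Fin K → ℝ) :
    ∫ ω, (effect c β (D.obs 0 ω) - t (cell (D.obs 0 ω)).1) ^ 2 ∂P =
      (β true - β false) ⬝ᵥ ((∑ k, D.rho P k • D.covStudy P k) *ᵥ (β true - β false)) +
        ∑ k, D.rho P k * (D.tauStudy P k - t k) ^ 2 := by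
  rw [hD.integral_eq_sum_study (hD.memLp_effect_sub t).integrable_sq, sum_mulVec, dotProduct_sum,
    ← Finset.sum_add_distrib]
  refine Finset.sum_congr rfl fun k _ => ?_
  rw [smul_mulVec, dotProduct_smul, smul_eq_mul, ← mul_add, ← hD.setIntegral_effect_sub_sq]
  exact setIntegral_congr_fun (hD.measurableSet_study k)
    fun ω (hω : D.H 0 ω = k) => by simp only [cell, obs, hω]

end TreatmentEffect

end IsCovariateShiftModel

section SecondMoments

variable (D P)

/-- The second moments `E(X'ᵀ X' 1_A)` of the covariates (with intercept) in the cells in `A`. -/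
def moment (A : Finset (Fin K × Bool)) : Matrix (Fin (d + 1)) (Fin (d + 1)) ℝ :=
  of fun a b => ∫ ω, ind A (D.obs 0 ω) * (design (D.obs 0 ω) a * design (D.obs 0 ω) b) ∂P

/-- The limit of `olsWeight n B A`. Row `0` of `moment P B` is the mean `E(X' 1_B)` because
`X' = (1, X)`. -/
def popWeight (B A : Finset (Fin K × Bool)) : Fin (d + 1) → ℝ :=
  D.moment P B 0 ᵥ* (D.moment P A)⁻¹

/-- The family of vectors which weights the residuals in the pooled estimator. -/
def poolWeight (q : Fin K × Bool) : Fin (d + 1) → ℝ :=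
  armSign q.2 • D.popWeight P univ (univ ×ˢ {q.2})

/-- The family of vectors which weights the residuals in the meta-analysis. -/
def metaWeight (q : Fin K × Bool) : Fin (d + 1) → ℝ :=
  armSign q.2 • D.popWeight P ({q.1} ×ˢ univ) {q}

include D in
lemma nonempty_arm [IsProbabilityMeasure P] (w : Bool) :
    ((univ : Finset (Fin K)) ×ˢ {w}).Nonempty :=
  have ⟨ω⟩ := nonempty_of_isProbabilityMeasure P
  ⟨(D.H 0 ω, w), by simp⟩

variable {D P}

lemma moment_transpose (A : Finset (Fin K × Bool)) : (D.moment P A)ᵀ = D.moment P A := by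
  ext a b
  simp only [moment, transpose_apply, of_apply, mul_comm (design _ b)]

namespace IsCovariateShiftModel

variable (hD : D.IsCovariateShiftModel P c β σ)
include hD

lemma integrable_ind_mul {f : Ω → ℝ} (hf : Integrable f P) (A : Finset (Fin K × Bool)) :
    Integrable (fun ω => ind A (D.obs 0 ω) * f ω) P := by
  refine hf.bdd_mul (c := 1) ((measurable_ind A).comp (hD.measurable_obs 0)).aestronglyMeasurable
    (Eventually.of_forall fun ω => ?_)
  simp only [ind]
  split_ifs <;> simp

lemma integral_ind_mul (A : Finset (Fin K × Bool)) (f : Ω → ℝ) :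
    ∫ ω, ind A (D.obs 0 ω) * f ω ∂P = ∫ ω in (fun ω => cell (D.obs 0 ω)) ⁻¹' A, f ω ∂P := by
  rw [← integral_indicator (hD.measurable_cell_obs A.measurableSet)]
  simp [ind, Set.indicator]

variable [IsProbabilityMeasure P]

lemma integrable_design_mul_design (a b : Fin (d + 1)) :
    Integrable (fun ω => design (D.obs 0 ω) a * design (D.obs 0 ω) b) P :=
  (hD.memLp_design a).integrable_mul (hD.memLp_design b)

lemma integrable_ind_mul_design_mul_design (A : Finset (Fin K × Bool)) (a b : Fin (d + 1)) :
    Integrable (fun ω => ind A (D.obs 0 ω) *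
      (design (D.obs 0 ω) a * design (D.obs 0 ω) b)) P :=
  hD.integrable_ind_mul (hD.integrable_design_mul_design a b) A

lemma dotProduct_moment_mulVec (A : Finset (Fin K × Bool)) (u v : Fin (d + 1) → ℝ) :
    u ⬝ᵥ (D.moment P A *ᵥ v) = ∫ ω, ind A (D.obs 0 ω) *
      ((design (D.obs 0 ω) ⬝ᵥ u) * (design (D.obs 0 ω) ⬝ᵥ v)) ∂P := by
  have expand (ω : Ω) : ind A (D.obs 0 ω) *
      ((design (D.obs 0 ω) ⬝ᵥ u) * (design (D.obs 0 ω) ⬝ᵥ v)) = ∑ a, ∑ b, u a *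
        (ind A (D.obs 0 ω) * (design (D.obs 0 ω) a * design (D.obs 0 ω) b) * v b) := by
    rw [dotProduct, dotProduct, Finset.sum_mul_sum]
    simp only [Finset.mul_sum]
    exact Finset.sum_congr rfl fun a _ => Finset.sum_congr rfl fun b _ => by ring
  have integrable_term (a b : Fin (d + 1)) : Integrable (fun ω => u a *
      (ind A (D.obs 0 ω) * (design (D.obs 0 ω) a * design (D.obs 0 ω) b) * v b)) P :=
    ((hD.integrable_ind_mul_design_mul_design A a b).mul_const _).const_mul _
  simp only [expand]
  rw [integral_finsetSum _ fun a _ => integrable_finsetSum _ fun b _ => integrable_term a b]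
  simp only [integral_finsetSum _ fun b _ => integrable_term _ b, integral_const_mul,
    integral_mul_const, dotProduct, mulVec, moment, of_apply, Finset.mul_sum]

lemma moment_eq_sum (A : Finset (Fin K × Bool)) : D.moment P A = ∑ q ∈ A, D.moment P {q} := by
  ext a b
  have ind_eq (ω : Ω) : ind A (D.obs 0 ω) = ∑ q ∈ A, ind {q} (D.obs 0 ω) := by simp [ind]
  simp only [Matrix.sum_apply, moment, of_apply, ind_eq, Finset.sum_mul]
  exact integral_finsetSum _ fun q _ => hD.integrable_ind_mul_design_mul_design {q} a b

lemma sum_moment_study : ∑ k, D.moment P ({k} ×ˢ univ) = D.moment P univ := by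
  rw [hD.moment_eq_sum univ, Fintype.sum_prod_type]
  refine Finset.sum_congr rfl fun k _ => ?_
  rw [hD.moment_eq_sum, Finset.sum_product, Finset.sum_singleton]

lemma sum_moment_cell (w : Bool) : ∑ k, D.moment P {(k, w)} = D.moment P (univ ×ˢ {w}) := by
  rw [hD.moment_eq_sum (univ ×ˢ {w}), Finset.sum_product]
  simp only [Finset.sum_singleton]

omit hD [MeasurableSpace Ω] [IsProbabilityMeasure P] in
lemma preimage_cell_study (k : Fin K) :
    (fun ω => cell (D.obs 0 ω)) ⁻¹' ↑({k} ×ˢ univ : Finset (Fin K × Bool)) = D.H 0 ⁻¹' {k} := by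
  ext ω
  simp only [Set.mem_preimage, Finset.mem_coe, mem_product, mem_univ, and_true, mem_singleton,
    Set.mem_singleton_iff, cell, obs]

lemma moment_singleton (q : Fin K × Bool) :
    D.moment P {q} = D.armProb P q • D.moment P ({q.1} ×ˢ univ) := by
  ext a b
  simp only [moment, of_apply, Matrix.smul_apply, smul_eq_mul]
  rw [hD.integral_ind_mul, hD.integral_ind_mul, preimage_cell_study, Finset.coe_singleton]
  exact hD.setIntegral_cell q (f := fun y => aug y.1 a * aug y.1 b)
    (((measurable_aug a).comp measurable_fst).mul ((measurable_aug b).comp measurable_fst))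

lemma dotProduct_moment_study_mulVec_self (k : Fin K) (v : Fin (d + 1) → ℝ) :
    v ⬝ᵥ (D.moment P ({k} ×ˢ univ) *ᵥ v) =
      D.rho P k * ∫ ω, (aug (D.X 0 ω) ⬝ᵥ v) ^ 2 ∂(D.studyMeasure P k) := by
  rw [hD.dotProduct_moment_mulVec, hD.integral_ind_mul, preimage_cell_study, hD.setIntegral_study]
  simp only [← sq, design, obs]

lemma posDef_moment {A : Finset (Fin K × Bool)} (hA : A.Nonempty) : (D.moment P A).PosDef := by
  have posDef_singleton (q : Fin K × Bool) : (D.moment P {q}).PosDef := by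
    refine PosDef.of_dotProduct_mulVec_pos (moment_transpose _) fun v hv => ?_
    rw [star_trivial, hD.moment_singleton, smul_mulVec, dotProduct_smul, smul_eq_mul,
      hD.dotProduct_moment_study_mulVec_self]
    exact mul_pos (hD.armProb_pos q)
      (mul_pos (hD.rho_pos q.1) (hD.integral_aug_dotProduct_sq_pos q.1 hv))
  rw [hD.moment_eq_sum]
  exact posDef_sum hA fun q _ => posDef_singleton q

lemma isUnit_det_moment {A : Finset (Fin K × Bool)} (hA : A.Nonempty) :
    IsUnit (D.moment P A).det :=
  (hD.posDef_moment hA).det_pos.ne'.isUnit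

lemma moment_mulVec_popWeight (B : Finset (Fin K × Bool)) {A : Finset (Fin K × Bool)}
    (hA : A.Nonempty) : D.moment P A *ᵥ D.popWeight P B A = D.moment P B 0 := by
  rw [popWeight, ← vecMul_transpose, moment_transpose, vecMul_vecMul,
    nonsing_inv_mul _ (hD.isUnit_det_moment hA), vecMul_one]

lemma metaWeight_eq (q : Fin K × Bool) :
    D.metaWeight P q = (armSign q.2 * (D.armProb P q)⁻¹) • Pi.single 0 1 := by
  have isUnit_study : IsUnit (D.moment P ({q.1} ×ˢ univ)).det :=
    hD.isUnit_det_moment ((singleton_nonempty _).product univ_nonempty)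
  rw [metaWeight, popWeight, hD.moment_singleton,
    inv_smul_of_ne_zero (hD.armProb_pos q).ne' isUnit_study, vecMul_smul, ← mul_apply_eq_vecMul,
    mul_nonsing_inv _ isUnit_study, smul_smul]
  congr 1
  ext a
  simp [one_apply, Pi.single_apply, eq_comm]

lemma integral_metaWeight_sq :
    ∫ ω, weight (D.metaWeight P) (D.obs 0 ω) ^ 2 ∂P =
      ∑ k, D.rho P k / (D.treatProb P k * (1 - D.treatProb P k)) := by
  have weight_eq (ω : Ω) : weight (D.metaWeight P) (D.obs 0 ω) ^ 2 =
      ((D.armProb P (cell (D.obs 0 ω)))⁻¹) ^ 2 := by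
    simp [weight, hD.metaWeight_eq, design, aug, mul_pow, sq (armSign _), armSign_mul_self]
  simp only [weight_eq]
  rw [hD.integral_apply_cell (r := fun q _ => (D.armProb P q)⁻¹ ^ 2) (fun _ => measurable_const)
    fun _ => integrable_const _, Fintype.sum_prod_type]
  refine Finset.sum_congr rfl fun k _ => ?_
  have treated_ne := (hD.treatProb_pos k).ne'
  have control_ne := (sub_pos.2 (hD.treatProb_lt_one k)).ne'
  have real_study : P.real (D.H 0 ⁻¹' {k}) = D.rho P k := rfl
  simp only [setIntegral_const, Fintype.sum_bool, armProb, smul_eq_mul, if_true,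
    Bool.false_eq_true, if_false, real_study]
  field_simp
  ring

lemma integral_weight_mul_weight (b b' : Fin K × Bool → Fin (d + 1) → ℝ) :
    ∫ ω, weight b (D.obs 0 ω) * weight b' (D.obs 0 ω) ∂P =
      ∑ q, b q ⬝ᵥ (D.moment P {q} *ᵥ b' q) := by
  have sum_cells (z : Obs d K) : weight b z * weight b' z =
      ∑ q, ind {q} z * ((design z ⬝ᵥ b q) * (design z ⬝ᵥ b' q)) := by
    simp [weight, ind]
  simp only [sum_cells, hD.dotProduct_moment_mulVec]
  exact integral_finsetSum _ fun q _ => hD.integrable_ind_mul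
    ((hD.memLp_weight fun _ => b q).integrable_mul (hD.memLp_weight fun _ => b' q)) {q}

lemma integral_poolWeight_mul_metaWeight :
    ∫ ω, weight (D.poolWeight P) (D.obs 0 ω) * weight (D.metaWeight P) (D.obs 0 ω) ∂P =
      ∫ ω, weight (D.poolWeight P) (D.obs 0 ω) ^ 2 ∂P := by
  have armSign_cancel (w : Bool) (r : ℝ) : armSign w * (armSign w * r) = r := by
    rw [← mul_assoc, armSign_mul_self, one_mul]
  have pool_mul_meta :
      ∫ ω, weight (D.poolWeight P) (D.obs 0 ω) * weight (D.metaWeight P) (D.obs 0 ω) ∂P =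
        ∑ w, D.popWeight P univ (univ ×ˢ {w}) ⬝ᵥ D.moment P univ 0 := by
    simp only [hD.integral_weight_mul_weight, poolWeight, metaWeight, mulVec_smul, smul_dotProduct,
      dotProduct_smul, smul_eq_mul, armSign_cancel,
      hD.moment_mulVec_popWeight _ (singleton_nonempty _), Fintype.sum_prod_type_right]
    refine Finset.sum_congr rfl fun w _ => ?_
    rw [← dotProduct_sum, ← hD.sum_moment_study]
    exact congrArg _ (Finset.sum_apply 0 _ _).symm
  have pool_sq : ∫ ω, weight (D.poolWeight P) (D.obs 0 ω) ^ 2 ∂P =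
      ∑ w, D.popWeight P univ (univ ×ˢ {w}) ⬝ᵥ D.moment P univ 0 := by
    simp only [sq, hD.integral_weight_mul_weight, poolWeight, mulVec_smul, smul_dotProduct,
      dotProduct_smul, smul_eq_mul, armSign_cancel, Fintype.sum_prod_type_right]
    simp only [← dotProduct_sum, ← sum_mulVec, hD.sum_moment_cell,
      hD.moment_mulVec_popWeight _ (nonempty_arm D P _)]
  rw [pool_mul_meta, pool_sq]

lemma integral_poolWeight_sq_le_integral_metaWeight_sq :
    ∫ ω, weight (D.poolWeight P) (D.obs 0 ω) ^ 2 ∂P ≤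
      ∫ ω, weight (D.metaWeight P) (D.obs 0 ω) ^ 2 ∂P :=
  integral_sq_le_integral_sq_of_integral_mul_eq (hD.memLp_weight _) (hD.memLp_weight _)
    hD.integral_poolWeight_mul_metaWeight

end IsCovariateShiftModel

end SecondMoments

section Asymptotics

omit [MeasurableSpace Ω] in
lemma dotProduct_score (v : Fin (d + 1) → ℝ) (n : ℕ) (A : Finset (Fin K × Bool)) (ω : Ω) :
    v ⬝ᵥ D.score c β n A ω = ∑ i ∈ range n,
      ind A (D.obs i ω) * (design (D.obs i ω) ⬝ᵥ v) * resid c β (D.obs i ω) := by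
  simp only [dotProduct, score_apply, Finset.mul_sum, Finset.sum_mul]
  rw [Finset.sum_comm]
  exact Finset.sum_congr rfl fun i _ => Finset.sum_congr rfl fun a _ => by ring

omit [MeasurableSpace Ω] in
lemma sum_influence {J : Type*} [Fintype J] (A : J → Finset (Fin K × Bool))
    (v : J → Fin (d + 1) → ℝ) (t : Fin K → ℝ) (n : ℕ) (ω : Ω) :
    ∑ i ∈ range n, influence c β t (fun q => ∑ j, if q ∈ A j then v j else 0) (D.obs i ω) =
      ∑ i ∈ range n, effect c β (D.obs i ω) - ∑ i ∈ range n, t (cell (D.obs i ω)).1 +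
        ∑ j, v j ⬝ᵥ D.score c β n (A j) ω := by
  simp only [influence, weight_sum_ite, Finset.sum_add_distrib, Finset.sum_sub_distrib,
    dotProduct_score, Finset.sum_mul]
  rw [Finset.sum_comm]

omit [MeasurableSpace Ω] in
lemma sampleEffect_add_sub_eq_influence_add {J : Type*} [Fintype J]
    (A : J → Finset (Fin K × Bool)) (u v : J → Fin (d + 1) → ℝ) (t : Fin K → ℝ) (n : ℕ) (ω : Ω) :
    D.sampleEffect c β n ω + (∑ j, u j ⬝ᵥ D.score c β n (A j) ω) / n -
        (∑ i ∈ range n, t (cell (D.obs i ω)).1) / n =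
      (∑ i ∈ range n, influence c β t (fun q => ∑ j, if q ∈ A j then v j else 0) (D.obs i ω)) / n +
        ∑ p : J × Fin (d + 1), (u p.1 p.2 - v p.1 p.2) * ((∑ i ∈ range n, ind (A p.1) (D.obs i ω) *
          (design (D.obs i ω) p.2 * resid c β (D.obs i ω))) / n) := by
  have remainder : ∑ p : J × Fin (d + 1), (u p.1 p.2 - v p.1 p.2) *
      (D.score c β n (A p.1) ω p.2 / n) =
        (∑ j, u j ⬝ᵥ D.score c β n (A j) ω - ∑ j, v j ⬝ᵥ D.score c β n (A j) ω) / n := by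
    simp only [Fintype.sum_prod_type, dotProduct, sub_mul, mul_div_assoc', Finset.sum_sub_distrib,
      sub_div, Finset.sum_div]
  simp only [← score_apply]
  rw [remainder, sampleEffect_eq, sum_influence]
  ring

namespace IsCovariateShiftModel

variable (hD : D.IsCovariateShiftModel P c β σ)
include hD

lemma ae_tendsto_sum_div {F : Obs d K → ℝ} (hF : Measurable F)
    (hint : Integrable (fun ω => F (D.obs 0 ω)) P) :
    ∀ᵐ ω ∂P, Tendsto (fun n : ℕ => (∑ i ∈ range n, F (D.obs i ω)) / n) atTop
      (𝓝 (∫ ω, F (D.obs 0 ω) ∂P)) :=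
  strong_law_ae_real (fun i ω => F (D.obs i ω)) hint
    (fun _ _ hij => (hD.indep.indepFun hij).comp hF hF) fun i => (hD.identDistrib i).comp hF

lemma isCenteredIID_comp_obs {F : Obs d K → ℝ} (hF : Measurable F)
    (hF2 : MemLp (fun ω => F (D.obs 0 ω)) 2 P) (hF0 : ∫ ω, F (D.obs 0 ω) ∂P = 0) :
    IsCenteredIID P fun i ω => F (D.obs i ω) where
  indep := hD.indep.comp (fun _ => F) fun _ => hF
  identDistrib i := (hD.identDistrib i).comp hF
  memLp_zero := hF2
  integral_zero := hF0

variable [IsProbabilityMeasure P]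

lemma ae_tendsto_gram (A : Finset (Fin K × Bool)) :
    ∀ᵐ ω ∂P, Tendsto (fun n : ℕ => (n : ℝ)⁻¹ • D.gram (D.idx n A ω) ω) atTop
      (𝓝 (D.moment P A)) := by
  have strong_law_entry (a b : Fin (d + 1)) :=
    hD.ae_tendsto_sum_div (F := fun z => ind A z * (design z a * design z b))
      ((measurable_ind A).mul ((measurable_design a).mul (measurable_design b)))
      (hD.integrable_ind_mul_design_mul_design A a b)
  filter_upwards [ae_all_iff.2 fun a => ae_all_iff.2 (strong_law_entry a)] with ω hω
  refine tendsto_pi_nhds.2 fun a => tendsto_pi_nhds.2 fun b => ?_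
  simp only [Matrix.smul_apply, gram_idx_apply, smul_eq_mul, inv_mul_eq_div]
  exact hω a b

lemma ae_tendsto_designSum (A : Finset (Fin K × Bool)) :
    ∀ᵐ ω ∂P, Tendsto (fun n : ℕ => (n : ℝ)⁻¹ • D.designSum n A ω) atTop
      (𝓝 (D.moment P A 0)) := by
  have designSum_eq_gram_row (n : ℕ) (ω : Ω) :
      D.designSum n A ω = D.gram (D.idx n A ω) ω 0 := by
    ext a
    simp [designSum_apply, gram_idx_apply, design, aug]
  filter_upwards [hD.ae_tendsto_gram A] with ω hω
  simp only [designSum_eq_gram_row]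
  exact tendsto_pi_nhds.1 hω 0

lemma ae_eventually_isUnit_det_gram {A : Finset (Fin K × Bool)} (hA : A.Nonempty) :
    ∀ᵐ ω ∂P, ∀ᶠ n : ℕ in atTop, IsUnit (D.gram (D.idx n A ω) ω).det := by
  filter_upwards [hD.ae_tendsto_gram A] with ω hω
  have tendsto_det := (continuous_id.matrix_det.tendsto (D.moment P A)).comp hω
  filter_upwards [tendsto_det.eventually_ne (hD.isUnit_det_moment hA).ne_zero] with n hn
  refine isUnit_iff_ne_zero.2 fun det_eq_zero => hn ?_
  simp [det_eq_zero]

lemma ae_eventually_localFullRank : ∀ᵐ ω ∂P, ∀ᶠ n : ℕ in atTop, D.LocalFullRank n ω := by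
  have isUnit_cell (q : Fin K × Bool) := hD.ae_eventually_isUnit_det_gram (singleton_nonempty q)
  filter_upwards [ae_all_iff.2 isUnit_cell] with ω hω
  filter_upwards [eventually_all.2 hω] with n hn
  refine (D.localFullRank_iff n ω).2 fun k w => ?_
  rw [← idx_cell]
  exact hn (k, w)

lemma ae_tendsto_olsWeight (B : Finset (Fin K × Bool)) {A : Finset (Fin K × Bool)}
    (hA : A.Nonempty) :
    ∀ᵐ ω ∂P, Tendsto (fun n : ℕ => D.olsWeight n B A ω) atTop (𝓝 (D.popWeight P B A)) := by
  filter_upwards [hD.ae_tendsto_designSum B, hD.ae_tendsto_gram A,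
    hD.ae_eventually_isUnit_det_gram hA] with ω tendsto_sum tendsto_gram isUnit_gram
  have continuous_vecMul : Continuous
      fun p : (Fin (d + 1) → ℝ) × Matrix (Fin (d + 1)) (Fin (d + 1)) ℝ => p.1 ᵥ* p.2 := by fun_prop
  refine ((continuous_vecMul.tendsto _).comp (tendsto_sum.prodMk_nhds
    (tendsto_matrix_inv tendsto_gram (hD.isUnit_det_moment hA)))).congr' ?_
  filter_upwards [isUnit_gram, eventually_gt_atTop 0] with n hdet hn
  have n_ne_zero : (n : ℝ) ≠ 0 := by positivity
  rw [Function.comp_apply, inv_smul_of_ne_zero (inv_ne_zero n_ne_zero) hdet, smul_vecMul,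
    vecMul_smul, smul_smul, inv_inv, inv_mul_cancel₀ n_ne_zero, one_smul, olsWeight]

/-- The factors `n⁻¹ ∑ ε X'` of the remainder are `O_P(n^{-1/2})`, so that estimated weights may be
replaced by their limits. -/
theorem hasAsympVar_of_eq_sampleEffect_add {J : Type*} [Fintype J]
    {A B : J → Finset (Fin K × Bool)} (hA : ∀ j, (A j).Nonempty) (s : J → ℝ) {t : Fin K → ℝ}
    (ht : ∫ ω, (effect c β (D.obs 0 ω) - t (cell (D.obs 0 ω)).1) ∂P = 0)
    {T C : ℕ → Ω → ℝ} (hTm : ∀ n, Measurable (T n)) (hCm : ∀ n, Measurable (C n))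
    (hC : ∀ᶠ n in atTop, ∀ ω, C n ω = (∑ i ∈ range n, t (cell (D.obs i ω)).1) / n)
    (hT : ∀ᵐ ω ∂P, ∀ᶠ n in atTop, T n ω = D.sampleEffect c β n ω +
      (∑ j, s j * (D.olsWeight n (B j) (A j) ω ⬝ᵥ D.score c β n (A j) ω)) / n) :
    HasAsympVar P T C (∫ ω, (effect c β (D.obs 0 ω) - t (cell (D.obs 0 ω)).1) ^ 2 ∂P +
      σ ^ 2 * ∫ ω, weight (fun q => ∑ j, if q ∈ A j then s j • D.popWeight P (B j) (A j) else 0)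
        (D.obs 0 ω) ^ 2 ∂P) := by
  set b : Fin K × Bool → Fin (d + 1) → ℝ :=
    fun q => ∑ j, if q ∈ A j then s j • D.popWeight P (B j) (A j) else 0
  have influence_centered : ∫ ω, influence c β t b (D.obs 0 ω) ∂P = 0 := by
    rw [hD.integral_influence, ht]
  have influence_memLp := hD.memLp_influence t b
  rw [← hD.integral_influence_sq t b, ← variance_of_integral_eq_zero
    influence_memLp.aestronglyMeasurable.aemeasurable influence_centered]
  refine hasAsympVar_of_asymptoticallyLinear
    (hD.isCenteredIID_comp_obs (measurable_influence c β t b) influence_memLp influence_centered)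
    (fun p : J × Fin (d + 1) => hD.isCenteredIID_comp_obs
      ((measurable_ind (A p.1)).mul ((measurable_design p.2).mul (measurable_resid c β)))
      (hD.memLp_ind_mul_design_mul_resid (A p.1) p.2)
      (hD.integral_ind_mul_design_mul_resid (A p.1) p.2))
    (A := fun p n ω => (s p.1 • D.olsWeight n (B p.1) (A p.1) ω) p.2 -
      (s p.1 • D.popWeight P (B p.1) (A p.1)) p.2)
    (fun p n => ?_) (fun p => ?_) (fun n => ((hTm n).sub (hCm n)).aemeasurable) ?_
  · exact (((D.measurable_olsWeight (fun i _ => D.measurable_features_obs hD.measurable_obs i)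
      _ _ _).const_mul _).sub_const _).aestronglyMeasurable
  · filter_upwards [hD.ae_tendsto_olsWeight (B p.1) (hA p.1)] with ω hω
    exact tendsto_sub_nhds_zero_iff.2 (tendsto_pi_nhds.1 (hω.const_smul (s p.1)) p.2)
  · filter_upwards [hT] with ω hω
    filter_upwards [hω, hC] with n hTn hCn
    simp only [hTn, hCn, ← smul_eq_mul, ← smul_dotProduct]
    exact sampleEffect_add_sub_eq_influence_add A _ _ t n ω

end IsCovariateShiftModel

end Asymptotics

section DesignSigma

variable (D)

omit [MeasurableSpace Ω] in
lemma assignmentSigma_le_designSigma (n : ℕ) : D.assignmentSigma n ≤ D.designSigma n := by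
  let _ := D.designSigma n
  exact (measurable_pi_lambda _ fun i : Fin n => D.measurable_cell_of_features
    (fun _ => D.measurable_features_designSigma) i.2).comap_le

/-- Coefficient of the residual of unit `i` in the error `tauMetaSW - sampleEffect`, under local
full rank. It depends on the design only. -/
def residCoeff (n i : ℕ) (ω : Ω) : ℝ :=
  ∑ q : Fin K × Bool, armSign q.2 * (ind {q} (D.obs i ω) *
    (design (D.obs i ω) ⬝ᵥ D.olsWeight n ({q.1} ×ˢ univ) {q} ω)) / n

omit [MeasurableSpace Ω] in
lemma measurable_residCoeff {n i : ℕ} (hi : i < n) :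
    Measurable[D.designSigma n] (D.residCoeff n i) := by
  have hF : ∀ i < n, Measurable[D.designSigma n] fun ω => features (D.obs i ω) :=
    fun _ => D.measurable_features_designSigma
  refine Finset.measurable_sum _ fun q _ => ((Measurable.mul ?_ ?_).const_mul _).div_const _
  · exact (measurable_of_finite fun q' => if q' ∈ ({q} : Finset _) then (1 : ℝ) else 0).comp
      (D.measurable_cell_of_features hF hi)
  · exact Finset.measurable_sum _ fun a _ =>
      (D.measurable_aug_of_features hF hi a).mul (D.measurable_olsWeight hF _ _ a)

omit [MeasurableSpace Ω] in
lemma tauMetaSW_sub_sampleEffect (c : Bool → ℝ) (β : Bool → Fin d → ℝ) {n : ℕ} {ω : Ω}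
    (h : D.LocalFullRank n ω) :
    D.tauMetaSW n ω - D.sampleEffect c β n ω =
      ∑ i ∈ range n, D.residCoeff n i ω * resid c β (D.obs i ω) := by
  rw [D.tauMetaSW_eq_sampleEffect_add c β ((D.localFullRank_iff n ω).1 h), add_sub_cancel_left]
  simp only [dotProduct_score, residCoeff, Finset.mul_sum, Finset.sum_mul, Finset.sum_div]
  rw [Finset.sum_comm]
  exact Finset.sum_congr rfl fun i _ => Finset.sum_congr rfl fun q _ => by ring

end DesignSigma

namespace IsCovariateShiftModel

variable [IsProbabilityMeasure P] (hD : D.IsCovariateShiftModel P c β σ)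
include hD

lemma integral_effect_sub (t : Fin K → ℝ) :
    ∫ ω, (effect c β (D.obs 0 ω) - t (cell (D.obs 0 ω)).1) ∂P =
      D.tau P - ∑ k, D.rho P k * t k := by
  rw [integral_sub hD.integrable_effect
    ((hD.memLp_cell fun q => t q.1).integrable one_le_two), hD.integral_effect,
    hD.integral_comp_study]

section AsymptoticVariances

variable {t : Fin K → ℝ} (ht : ∑ k, D.rho P k * t k = D.tau P) {C : ℕ → Ω → ℝ}
  (hCm : ∀ n, Measurable (C n))
  (hC : ∀ᶠ n in atTop, ∀ ω, C n ω = (∑ i ∈ range n, t (cell (D.obs i ω)).1) / n)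
include ht hCm hC

lemma hasAsympVar_of_eq_tauPool {T : ℕ → Ω → ℝ} (hTm : ∀ n, Measurable (T n))
    (hT : ∀ n ω, D.LocalFullRank n ω → T n ω = D.tauPool n ω) :
    HasAsympVar P T C
      (∫ ω, (effect c β (D.obs 0 ω) - t (cell (D.obs 0 ω)).1) ^ 2 ∂P +
        σ ^ 2 * ∫ ω, weight (D.poolWeight P) (D.obs 0 ω) ^ 2 ∂P) := by
  have poolWeight_eq_sum : D.poolWeight P = fun q => ∑ w, if q ∈ (univ : Finset (Fin K)) ×ˢ {w}
      then armSign w • D.popWeight P univ (univ ×ˢ {w}) else 0 := by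
    ext1 q
    simp only [poolWeight, mem_product, mem_univ, true_and, mem_singleton, Finset.sum_ite_eq,
      if_true]
  rw [poolWeight_eq_sum]
  refine hD.hasAsympVar_of_eq_sampleEffect_add (nonempty_arm D P) armSign
    (by rw [hD.integral_effect_sub, ht, sub_self]) hTm hCm hC ?_
  filter_upwards [hD.ae_eventually_localFullRank] with ω eventually_localFullRank
  filter_upwards [eventually_localFullRank] with n h
  rw [hT n ω h, D.tauPool_eq_sampleEffect_add c β h.isUnit_det_gram_armIdx]

lemma hasAsympVar_tauMetaSW :
    HasAsympVar P D.tauMetaSW C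
      (∫ ω, (effect c β (D.obs 0 ω) - t (cell (D.obs 0 ω)).1) ^ 2 ∂P +
        σ ^ 2 * ∫ ω, weight (D.metaWeight P) (D.obs 0 ω) ^ 2 ∂P) := by
  have metaWeight_eq_sum : D.metaWeight P = fun q => ∑ q' : Fin K × Bool,
      if q ∈ ({q'} : Finset _) then armSign q'.2 • D.popWeight P ({q'.1} ×ˢ univ) {q'} else 0 := by
    ext1 q
    simp only [metaWeight, mem_singleton, Finset.sum_ite_eq, mem_univ, if_true]
  rw [metaWeight_eq_sum]
  refine hD.hasAsympVar_of_eq_sampleEffect_add singleton_nonempty (fun q => armSign q.2)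
    (by rw [hD.integral_effect_sub, ht, sub_self]) (D.measurable_tauMetaSW hD.measurable_obs)
    hCm hC ?_
  filter_upwards [hD.ae_eventually_localFullRank] with ω eventually_localFullRank
  filter_upwards [eventually_localFullRank] with n h
  exact D.tauMetaSW_eq_sampleEffect_add c β ((D.localFullRank_iff n ω).1 h)

theorem exists_hasAsympVar {η : ℕ → Bool → Ω → ℝ} (hη : D.IsLearningRate η)
    (θ₀ : Bool → Fin (d + 1) → ℝ) :
    ∃ v, HasAsympVar P D.tauPool C v ∧ HasAsympVar P (D.tauGD η θ₀) C v ∧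
      HasAsympVar P (D.tauIVW σ) C v ∧
      HasAsympVar P D.tauMetaSW C
        (D.metaVar P β σ + ∑ k, D.rho P k * (D.tauStudy P k - t k) ^ 2) ∧
      v ≤ D.metaVar P β σ + ∑ k, D.rho P k * (D.tauStudy P k - t k) ^ 2 := by
  have hm := hD.measurable_obs
  have variance_tauMetaSW : D.metaVar P β σ + ∑ k, D.rho P k * (D.tauStudy P k - t k) ^ 2 =
      ∫ ω, (effect c β (D.obs 0 ω) - t (cell (D.obs 0 ω)).1) ^ 2 ∂P +
        σ ^ 2 * ∫ ω, weight (D.metaWeight P) (D.obs 0 ω) ^ 2 ∂P := by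
    rw [hD.integral_effect_sub_sq, hD.integral_metaWeight_sq, metaVar]
    ring
  rw [variance_tauMetaSW]
  refine ⟨_,
    hD.hasAsympVar_of_eq_tauPool ht hCm hC (D.measurable_tauPool hm) fun _ _ _ => rfl,
    hD.hasAsympVar_of_eq_tauPool ht hCm hC (D.measurable_tauGD hm hη.1 θ₀)
      fun _ _ => tauGD_eq_tauPool hη θ₀,
    hD.hasAsympVar_of_eq_tauPool ht hCm hC (D.measurable_tauIVW hm σ)
      fun _ _ => tauIVW_eq_tauPool hD.sigma_pos.ne',
    hD.hasAsympVar_tauMetaSW ht hCm hC, ?_⟩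
  gcongr _ + σ ^ 2 * ?_
  exact hD.integral_poolWeight_sq_le_integral_metaWeight_sq

end AsymptoticVariances

theorem exists_hasAsympVar_tau {η : ℕ → Bool → Ω → ℝ} (hη : D.IsLearningRate η)
    (θ₀ : Bool → Fin (d + 1) → ℝ) :
    ∃ v, HasAsympVar P D.tauPool (fun _ _ => D.tau P) v ∧
      HasAsympVar P (D.tauGD η θ₀) (fun _ _ => D.tau P) v ∧
      HasAsympVar P (D.tauIVW σ) (fun _ _ => D.tau P) v ∧
      HasAsympVar P D.tauMetaSW (fun _ _ => D.tau P) (D.metaVar P β σ + D.betweenVar P) ∧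
      v ≤ D.metaVar P β σ + D.betweenVar P := by
  have sum_rho_mul_tau : ∑ k, D.rho P k * D.tau P = D.tau P := by
    rw [← hD.integral_comp_study fun _ => D.tau P]
    simp
  refine hD.exists_hasAsympVar sum_rho_mul_tau (fun _ => measurable_const) ?_ hη θ₀
  filter_upwards [eventually_gt_atTop 0] with n hn _
  have n_ne_zero : (n : ℝ) ≠ 0 := by positivity
  simp [n_ne_zero]

theorem exists_hasAsympVar_tauGivenH {η : ℕ → Bool → Ω → ℝ} (hη : D.IsLearningRate η)
    (θ₀ : Bool → Fin (d + 1) → ℝ) :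
    ∃ v, HasAsympVar P D.tauPool (D.tauGivenH P) v ∧
      HasAsympVar P (D.tauGD η θ₀) (D.tauGivenH P) v ∧
      HasAsympVar P (D.tauIVW σ) (D.tauGivenH P) v ∧
      HasAsympVar P D.tauMetaSW (D.tauGivenH P) (D.metaVar P β σ) ∧ v ≤ D.metaVar P β σ := by
  simpa using hD.exists_hasAsympVar hD.sum_rho_mul_tauStudy
    (D.measurable_tauGivenH hD.measurable_obs P)
    (Eventually.of_forall (D.tauGivenH_eq P)) hη θ₀

section Unbiasedness

omit [IsProbabilityMeasure P] in
lemma designSigma_le (n : ℕ) : D.designSigma n ≤ (inferInstance : MeasurableSpace Ω) :=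
  (measurable_pi_lambda _ fun i : Fin n =>
    D.measurable_features_obs hD.measurable_obs i).comap_le

omit [IsProbabilityMeasure P] in
lemma integrable_comp_obs {r : Obs d K → ℝ} (hr : Measurable r)
    (hri : Integrable (fun ω => r (D.obs 0 ω)) P) (i : ℕ) :
    Integrable (fun ω => r (D.obs i ω)) P :=
  ((hD.identDistrib i).comp hr).integrable_iff.2 hri

lemma setIntegral_comp_obs_eq_zero {G : Type*} [MeasurableSpace G] {f : Obs d K → G}
    (hf : Measurable f) {r : Obs d K → ℝ} (hr : Measurable r)
    (hri : Integrable (fun ω => r (D.obs 0 ω)) P)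
    (h0 : ∀ B, MeasurableSet B →
      ∫ ω in (fun ω => f (D.obs 0 ω)) ⁻¹' B, r (D.obs 0 ω) ∂P = 0)
    {n i : ℕ} (hi : i < n) {S : Set Ω}
    (hS : MeasurableSet[MeasurableSpace.comap (fun ω (j : Fin n) => f (D.obs j ω))
      inferInstance] S) :
    ∫ ω in S, r (D.obs i ω) ∂P = 0 := by
  have hm := hD.measurable_obs
  refine setIntegral_eq_zero_of_iIndepFun (i := ⟨i, hi⟩) (fun j => hm j)
    (hD.indep.precomp Fin.val_injective) hf hr (hD.integrable_comp_obs hr hri i) (fun B hB => ?_) hS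
  have setIntegral_eq_map (j : ℕ) : ∫ ω in (fun ω => f (D.obs j ω)) ⁻¹' B, r (D.obs j ω) ∂P =
      ∫ z in f ⁻¹' B, r z ∂(P.map (D.obs j)) :=
    (setIntegral_map (hf hB) hr.aestronglyMeasurable (hm j).aemeasurable).symm
  have map_obs : P.map (D.obs i) = P.map (D.obs 0) := (hD.identDistrib i).map_eq
  exact (setIntegral_eq_map i).trans (by rw [map_obs, ← setIntegral_eq_map, h0 B hB])

lemma setIntegral_resid_eq_zero {n i : ℕ} (hi : i < n) {S : Set Ω}
    (hS : MeasurableSet[D.designSigma n] S) : ∫ ω in S, resid c β (D.obs i ω) ∂P = 0 :=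
  hD.setIntegral_comp_obs_eq_zero measurable_features (measurable_resid c β)
    (hD.memLp_resid.integrable one_le_two) (fun _ => hD.setIntegral_features_resid) hi hS

lemma setIntegral_cell_effect_sub_tauStudy (B : Set (Fin K × Bool)) :
    ∫ ω in (fun ω => cell (D.obs 0 ω)) ⁻¹' B,
      (effect c β (D.obs 0 ω) - D.tauStudy P (cell (D.obs 0 ω)).1) ∂P = 0 := by
  classical
  have measurable_effect_sub (k : Fin K) : Measurable fun y : (Fin d → ℝ) × ℝ × ℝ =>
      aug y.1 ⬝ᵥ (theta c β true - theta c β false) - D.tauStudy P k := by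
    simp only [dotProduct]
    exact (Finset.measurable_sum _ fun a _ =>
      ((measurable_aug a).comp measurable_fst).mul_const _).sub_const _
  have cell_eq_zero (q : Fin K × Bool) : ∫ ω in (fun ω => cell (D.obs 0 ω)) ⁻¹' {q},
      (effect c β (D.obs 0 ω) - D.tauStudy P q.1) ∂P = 0 := by
    refine (hD.setIntegral_cell q (measurable_effect_sub q.1)).trans (mul_eq_zero_of_right _ ?_)
    change ∫ ω in D.H 0 ⁻¹' {q.1}, (effect c β (D.obs 0 ω) - D.tauStudy P q.1) ∂P = 0
    rw [integral_sub hD.integrable_effect.integrableOn (integrable_const _), hD.setIntegral_effect,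
      setIntegral_const]
    exact sub_self _
  have preimage_eq : (fun ω => cell (D.obs 0 ω)) ⁻¹' B =
      ⋃ q ∈ B.toFinset, (fun ω => cell (D.obs 0 ω)) ⁻¹' {q} := by
    ext ω
    simp
  have measurableSet_cell (q : Fin K × Bool) :
      MeasurableSet ((fun ω => cell (D.obs 0 ω)) ⁻¹' {q}) :=
    hD.measurable_cell_obs (measurableSet_singleton q)
  rw [preimage_eq, integral_biUnion_finset _ (fun q _ => measurableSet_cell q)
    (fun _ _ _ _ hne => Disjoint.preimage _ (Set.disjoint_singleton.2 hne))
    fun _ _ => ((hD.memLp_effect_sub (D.tauStudy P)).integrable one_le_two).integrableOn]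
  refine Finset.sum_eq_zero fun q _ => (setIntegral_congr_fun (measurableSet_cell q) ?_).trans
    (cell_eq_zero q)
  intro ω hω
  simp only [Set.mem_preimage, Set.mem_singleton_iff] at hω
  simp only [hω]

lemma integrable_effect_obs (i : ℕ) : Integrable (fun ω => effect c β (D.obs i ω)) P :=
  hD.integrable_comp_obs (measurable_effect c β) hD.integrable_effect i

lemma integrable_tauStudy_obs (i : ℕ) :
    Integrable (fun ω => D.tauStudy P (cell (D.obs i ω)).1) P :=
  hD.integrable_comp_obs (measurable_comp_cell fun q => D.tauStudy P q.1)
    ((hD.memLp_cell fun q => D.tauStudy P q.1).integrable one_le_two) i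

lemma integrable_sampleEffect (n : ℕ) : Integrable (D.sampleEffect c β n) P :=
  ((integrable_finsetSum _ fun i _ => hD.integrable_effect_obs i).div_const (n : ℝ)).congr
    (Eventually.of_forall fun ω => (D.sampleEffect_eq c β n ω).symm)

lemma setIntegral_sampleEffect_eq_tauGivenH {n : ℕ} {S : Set Ω}
    (hS : MeasurableSet[D.assignmentSigma n] S) :
    ∫ ω in S, D.sampleEffect c β n ω ∂P = ∫ ω in S, D.tauGivenH P n ω ∂P := by
  have unit_eq {i : ℕ} (hi : i < n) : ∫ ω in S, effect c β (D.obs i ω) ∂P =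
      ∫ ω in S, D.tauStudy P (cell (D.obs i ω)).1 ∂P := by
    rw [← sub_eq_zero, ← integral_sub (hD.integrable_effect_obs i).integrableOn
      (hD.integrable_tauStudy_obs i).integrableOn]
    exact hD.setIntegral_comp_obs_eq_zero measurable_cell
      (r := fun z => effect c β z - D.tauStudy P (cell z).1)
      ((measurable_effect c β).sub (measurable_comp_cell fun q => D.tauStudy P q.1))
      ((hD.memLp_effect_sub _).integrable one_le_two)
      (fun B _ => hD.setIntegral_cell_effect_sub_tauStudy B) hi hS
  simp only [sampleEffect_eq, tauGivenH_eq]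
  rw [integral_div, integral_div,
    integral_finsetSum _ fun i _ => (hD.integrable_effect_obs i).integrableOn,
    integral_finsetSum _ fun i _ => (hD.integrable_tauStudy_obs i).integrableOn,
    Finset.sum_congr rfl fun i hi => unit_eq (mem_range.1 hi)]

theorem setIntegral_tauMetaSW_eq_sampleEffect {n : ℕ} {S : Set Ω}
    (hS : MeasurableSet[D.designSigma n] S) (hfull : ∀ᵐ ω ∂P, ω ∈ S → D.LocalFullRank n ω)
    (hint : IntegrableOn (D.tauMetaSW n) S P) :
    ∫ ω in S, D.tauMetaSW n ω ∂P = ∫ ω in S, D.sampleEffect c β n ω ∂P := by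
  have hle := hD.designSigma_le n
  have error_eq : (fun ω => D.tauMetaSW n ω - D.sampleEffect c β n ω) =ᵐ[P.restrict S]
      fun ω => ∑ i ∈ range n, D.residCoeff n i ω * resid c β (D.obs i ω) :=
    (ae_restrict_iff' (hle _ hS)).2 <| hfull.mono fun ω hω hωS =>
      D.tauMetaSW_sub_sampleEffect c β (hω hωS)
  have integrable_sampleEffect := (hD.integrable_sampleEffect n).integrableOn (s := S)
  rw [← sub_eq_zero, ← integral_sub hint integrable_sampleEffect, integral_congr_ae error_eq]
  exact setIntegral_sum_mul_eq_zero_of_setIntegral_eq_zero hle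
    (fun i hi => D.measurable_residCoeff (mem_range.1 hi))
    (fun i _ => hD.integrable_comp_obs (measurable_resid c β)
      (hD.memLp_resid.integrable one_le_two) i)
    (fun i hi _ => hD.setIntegral_resid_eq_zero (mem_range.1 hi)) hS
    ((hint.sub integrable_sampleEffect).congr error_eq)

theorem setIntegral_tauMetaSW_eq_tauGivenH {n : ℕ} {S : Set Ω}
    (hS : MeasurableSet[D.assignmentSigma n] S) (hfull : ∀ᵐ ω ∂P, ω ∈ S → D.LocalFullRank n ω)
    (hint : IntegrableOn (D.tauMetaSW n) S P) :
    ∫ ω in S, D.tauMetaSW n ω ∂P = ∫ ω in S, D.tauGivenH P n ω ∂P := by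
  rw [hD.setIntegral_tauMetaSW_eq_sampleEffect (D.assignmentSigma_le_designSigma n _ hS) hfull hint,
    hD.setIntegral_sampleEffect_eq_tauGivenH hS]

theorem integral_sampleEffect {n : ℕ} (hn : 0 < n) :
    ∫ ω, D.sampleEffect c β n ω ∂P = D.tau P := by
  have integral_effect_obs (i : ℕ) : ∫ ω, effect c β (D.obs i ω) ∂P = D.tau P :=
    ((hD.identDistrib i).comp (measurable_effect c β)).integral_eq.trans hD.integral_effect
  have n_ne_zero : (n : ℝ) ≠ 0 := by positivity
  simp only [sampleEffect_eq]
  rw [integral_div, integral_finsetSum _ fun i _ => hD.integrable_effect_obs i]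
  simp [integral_effect_obs, n_ne_zero]

theorem integral_tauGivenH {n : ℕ} (hn : 0 < n) : ∫ ω, D.tauGivenH P n ω ∂P = D.tau P := by
  simpa [hD.integral_sampleEffect hn] using
    (hD.setIntegral_sampleEffect_eq_tauGivenH (n := n) MeasurableSet.univ).symm

lemma tendsto_measureReal_localFullRank :
    Tendsto (fun n => P.real {ω | D.LocalFullRank n ω}) atTop (𝓝 1) := by
  have measurableSet_localFullRank (n : ℕ) : MeasurableSet {ω | D.LocalFullRank n ω} :=
    D.measurableSet_localFullRank fun i _ => D.measurable_features_obs hD.measurable_obs i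
  have tendsto_measure : Tendsto (fun n => P {ω | D.LocalFullRank n ω}) atTop (𝓝 (P Set.univ)) :=
    tendsto_measure_of_ae_tendsto_indicator_of_isFiniteMeasure atTop MeasurableSet.univ
      measurableSet_localFullRank
      (hD.ae_eventually_localFullRank.mono fun ω hω => by simpa using hω)
  simpa [Measure.real, Function.comp_def] using
    (ENNReal.tendsto_toReal (measure_ne_top P _)).comp tendsto_measure

lemma tendsto_integral_abs_sampleEffect_sub_tau :
    Tendsto (fun n => ∫ ω, |D.sampleEffect c β n ω - D.tau P| ∂P) atTop (𝓝 0) := by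
  have tendsto_eLpNorm := strong_law_Lp (μ := P) (p := 1) le_rfl ENNReal.one_ne_top
    (fun i ω => effect c β (D.obs i ω)) (memLp_one_iff_integrable.2 hD.integrable_effect)
    (fun _ _ hij => (hD.indep.indepFun hij).comp (measurable_effect c β)
      (measurable_effect c β)) fun i => (hD.identDistrib i).comp (measurable_effect c β)
  rw [hD.integral_effect] at tendsto_eLpNorm
  refine ((ENNReal.tendsto_toReal ENNReal.zero_ne_top).comp tendsto_eLpNorm).congr fun n => ?_
  have average_eq (ω : Ω) : (n : ℝ)⁻¹ • ∑ i ∈ range n, effect c β (D.obs i ω) =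
      D.sampleEffect c β n ω := by
    rw [sampleEffect_eq, smul_eq_mul, inv_mul_eq_div]
  simp only [Function.comp_apply, average_eq, eLpNorm_one_eq_lintegral_enorm]
  exact (integral_norm_eq_lintegral_enorm
    ((hD.integrable_sampleEffect n).sub (integrable_const _)).aestronglyMeasurable).symm

lemma tendsto_setIntegral_sampleEffect_sub_tau (S : ℕ → Set Ω) :
    Tendsto (fun n => ∫ ω in S n, (D.sampleEffect c β n ω - D.tau P) ∂P) atTop (𝓝 0) := by
  refine squeeze_zero_norm (fun n => ?_) hD.tendsto_integral_abs_sampleEffect_sub_tau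
  exact (norm_integral_le_integral_norm _).trans (setIntegral_le_integral
    ((hD.integrable_sampleEffect n).sub (integrable_const _)).norm
    (Eventually.of_forall fun _ => norm_nonneg _))

theorem tendsto_integral_tauMetaSW_cond
    (hint : ∀ᶠ n in atTop, IntegrableOn (D.tauMetaSW n) {ω | D.LocalFullRank n ω} P) :
    Tendsto (fun n : ℕ => ∫ ω, D.tauMetaSW n ω ∂P[|{ω | D.LocalFullRank n ω}]) atTop
      (𝓝 (D.tau P)) := by
  set F : ℕ → Set Ω := fun n => {ω | D.LocalFullRank n ω}
  have measurableSet_F (n : ℕ) : MeasurableSet[D.designSigma n] (F n) :=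
    D.measurableSet_localFullRank fun _ => D.measurable_features_designSigma
  have tendsto_prob : Tendsto (fun n => P.real (F n)) atTop (𝓝 1) :=
    hD.tendsto_measureReal_localFullRank
  have tendsto_tau_add : Tendsto (fun n => D.tau P + (P.real (F n))⁻¹ *
      ∫ ω in F n, (D.sampleEffect c β n ω - D.tau P) ∂P) atTop (𝓝 (D.tau P)) := by
    simpa using ((tendsto_prob.inv₀ one_ne_zero).mul
      (hD.tendsto_setIntegral_sampleEffect_sub_tau F)).const_add (D.tau P)
  refine tendsto_tau_add.congr' ?_
  filter_upwards [hint, tendsto_prob.eventually_ne one_ne_zero] with n hn prob_ne_zero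
  rw [ProbabilityTheory.cond, integral_smul_measure, ENNReal.toReal_inv, smul_eq_mul,
    hD.setIntegral_tauMetaSW_eq_sampleEffect (measurableSet_F n)
      (Eventually.of_forall fun ω h => h) hn,
    integral_sub (hD.integrable_sampleEffect n).integrableOn (integrable_const _),
    setIntegral_const, smul_eq_mul, mul_sub, inv_mul_cancel_left₀ prob_ne_zero]
  exact add_sub_cancel _ _

end Unbiasedness

end IsCovariateShiftModel

end Units

end FedRCT

end

theorem mainTheorem6 {Ω : Type*} [MeasurableSpace Ω] (P : Measure Ω) [IsProbabilityMeasure P]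
    {d K : ℕ} (D : FedRCT.Units Ω d K) (c : Bool → ℝ) (β : Bool → Fin d → ℝ) (σ : ℝ)
    (hD : D.IsCovariateShiftModel P c β σ)
    (η : ℕ → Bool → Ω → ℝ) (hη : D.IsLearningRate η) (θ₀ : Bool → Fin (d + 1) → ℝ) :
    -- comparison of the asymptotic variances
    (∃ v : ℝ,
      FedRCT.HasAsympVar P D.tauPool (fun _ _ => D.tau P) v ∧
      FedRCT.HasAsympVar P (D.tauGD η θ₀) (fun _ _ => D.tau P) v ∧
      FedRCT.HasAsympVar P (D.tauIVW σ) (fun _ _ => D.tau P) v ∧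
      FedRCT.HasAsympVar P D.tauMetaSW (fun _ _ => D.tau P)
        (D.metaVar P β σ + D.betweenVar P) ∧
      v ≤ D.metaVar P β σ + D.betweenVar P) ∧
    -- the same comparison, the variability of the memberships being removed
    (∃ v : ℝ,
      FedRCT.HasAsympVar P D.tauPool (D.tauGivenH P) v ∧
      FedRCT.HasAsympVar P (D.tauGD η θ₀) (D.tauGivenH P) v ∧
      FedRCT.HasAsympVar P (D.tauIVW σ) (D.tauGivenH P) v ∧
      FedRCT.HasAsympVar P D.tauMetaSW (D.tauGivenH P) (D.metaVar P β σ) ∧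
      v ≤ D.metaVar P β σ) ∧
    -- unbiasedness of Meta-SW given the memberships and treatments
    (∀ (n : ℕ) (S : Set Ω), MeasurableSet[D.assignmentSigma n] S →
      (∀ᵐ ω ∂P, ω ∈ S → D.LocalFullRank n ω) → IntegrableOn (D.tauMetaSW n) S P →
      ∫ ω in S, D.tauMetaSW n ω ∂P = ∫ ω in S, D.tauGivenH P n ω ∂P) ∧
    (∀ n : ℕ, 0 < n → ∫ ω, D.tauGivenH P n ω ∂P = D.tau P) ∧
    -- unbiasedness of Meta-SW given the whole design
    (∀ (n : ℕ) (S : Set Ω), MeasurableSet[D.designSigma n] S →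
      (∀ᵐ ω ∂P, ω ∈ S → D.LocalFullRank n ω) → IntegrableOn (D.tauMetaSW n) S P →
      ∫ ω in S, D.tauMetaSW n ω ∂P =
        ∫ ω in S, D.sampleEffect c β n ω ∂P) ∧
    (∀ n : ℕ, 0 < n →
      ∫ ω, D.sampleEffect c β n ω ∂P = D.tau P) ∧
    -- asymptotic unbiasedness on the event of local full rank
    ((∀ᶠ n in atTop, IntegrableOn (D.tauMetaSW n) {ω | D.LocalFullRank n ω} P) →
      Tendsto (fun n : ℕ => ∫ ω, D.tauMetaSW n ω ∂P[|{ω | D.LocalFullRank n ω}]) atTop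
        (𝓝 (D.tau P))) := by
  refine ⟨hD.exists_hasAsympVar_tau hη θ₀, hD.exists_hasAsympVar_tauGivenH hη θ₀, ?_, ?_, ?_, ?_,
    hD.tendsto_integral_tauMetaSW_cond⟩
  · exact fun _ _ hS hfull hint => hD.setIntegral_tauMetaSW_eq_tauGivenH hS hfull hint
  · exact fun _ hn => hD.integral_tauGivenH hn
  · exact fun _ _ hS hfull hint => hD.setIntegral_tauMetaSW_eq_sampleEffect hS hfull hint
  · exact fun _ hn => hD.integral_sampleEffect hn
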